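/- Let $J$ be a simple finite-dimensional Euclidean Jordan algebra over $\mathbb R$ with identity $e$, that is, a real inner product space with a commutative bilinear product with unit $e$ satisfying $x(x^2y)=x^2(xy)$ and $\langle xy,z\rangle=\langle x,yz\rangle$, having no non-trivial ideals. Let $n=\dim J$, let $L(x)y=xy$ and $P(x)=2L(x)^2-L(x^2)$, and let $\Omega$ be the cone of positive elements, i.e. the interior of the set of squares. For $x\in\Omega$ let $x^{1/2}$ be the square root of $x$ in $\Omega$; $x^{-1}$ denotes the inverse in $J$, i.e. the element of $\mathbb R[x]$ with $x\,x^{-1}=e$. For $x\in\Omega$ and $y\in J$ put $x\star y=P(x^{1/2})y$. A Jordan frame is a maximal system $c_1,\dots,c_r$ of pairwise orthogonal primitive idempotents; every $x\in J$ can be written $x=\sum_i\xi_ic_i$ for some Jordan frame, the $\xi_i$ (with multiplicity) are the eigenvalues of $x$, and $\operatorname{tr}(x)$ and $\det(x)$ are their sum and product. Let $G$ be the identity component of $\{g\in GL(J): g\Omega=\Omega\}$ and $K$ the stabilizer of $e$ in $G$, a compact group with normalized Haar measure $\mu_K$. Fix a Jordan frame $c_1,\dots,c_r$ of $J$ and let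 $e_j=c_1+\dots+c_j$. Let $\Delta_j(x)$ be the determinant, in the Jordan algebra $J(e_j,1)=\{z: e_jz=z\}$, of the orthogonal projection of $x$ to $J(e_j,1)$. Put $\Delta_s=\prod_{j}\Delta_j^{s_j-s_{j+1}}$ with $s_{r+1}=0$, and $\Gamma_\Omega(s)=\int_\Omega e^{-\operatorname{tr}x}\Delta_s(x)\det(x)^{-n/r}\,dx$. For a partition $\lambda=(\lambda_1\ge\dots\ge\lambda_r\ge0)$ of weight $|\lambda|=\lambda_1+\dots+\lambda_r$, the zonal polynomial is $$Z_\lambda(x)=d_\lambda\,\frac{|\lambda|!}{(n/r)_\lambda}\int_K\Delta_\lambda(kx)\,d\mu_K(k),\qquad (n/r)_\lambda=\frac{\Gamma_\Omega(n/r+\lambda)}{\Gamma_\Omega(n/r)},$$ where $d_\lambda$ is the dimension of the span of the functions $x\mapsto\Delta_\lambda(g^{-1}x)$, $g\in G$. **Lemma.** Let $x,y\in\Omega$. Then (a) $x\star e=e\star x=x$, $\;x\star x^{-1}=x^{-1}\star x=e$, and $(x\star y)^{-1}=x^{-1}\star y^{-1}$. (b) $x\star y$ and $y\star x$ have the same eigenvalues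 (with multiplicity); both lie in $\Omega$, and every $K$-invariant function on $\Omega$ takes the same value on $x\star y$ and $y\star x$. In particular $\det(x\star y)=\det(y\star x)=\det(x)\det(y)$, $\operatorname{tr}(x\star y)=\operatorname{tr}(y\star x)=\operatorname{tr}(xy)$, and $Z_\lambda(x\star y)=Z_\lambda(y\star x)$ for every partition $\lambda$. -/

import Mathlib

open scoped Pointwise

/-- A Euclidean Jordan algebra: a real inner product space with a commutative bilinear product with
unit `1` satisfying the Jordan identity, for which the inner product is associative.
(Finite-dimensionality is the separate class `FiniteDimensional ℝ J`.) -/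
class EuclideanJordanAlgebra (J : Type*) extends NormedAddCommGroup J, NonAssocCommRing J,
    InnerProductSpace ℝ J, IsScalarTower ℝ J J, IsCommJordan J where
  inner_mul_assoc : ∀ x y z : J, Inner.inner ℝ (x * y) z = Inner.inner ℝ x (y * z)

namespace EuclideanJordanAlgebra

section Basic

variable {J : Type*} [EuclideanJordanAlgebra J]

instance : SMulCommClass ℝ J J where
  smul_comm r x y := by
    simp only [smul_eq_mul]
    rw [mul_comm x y, ← smul_mul_assoc, mul_comm]

/-- The quadratic representation `P(x) = 2 L(x)² - L(x²)`, where `L(x) y = x * y`. -/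
noncomputable def quadRep (x : J) : J →ₗ[ℝ] J :=
  (2 : ℝ) • (LinearMap.mulLeft ℝ x ∘ₗ LinearMap.mulLeft ℝ x) - LinearMap.mulLeft ℝ (x * x)

variable (J) in
/-- The set of squares. -/
def squares : Set J := Set.range fun x : J => x * x

variable (J) in
/-- The cone `Ω` of positive elements: the interior of the set of squares. -/
def cone : Set J := interior (squares J)

open Classical in
/-- The square root `x^{1/2}` of `x ∈ Ω`: the element of `Ω` whose square is `x`. -/
noncomputable def sqrt (x : J) : J :=
  if h : ∃ z ∈ cone J, z * z = x then h.choose else 0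

open Classical in
/-- The inverse of `x` in the Jordan algebra: the element `y` of `ℝ[x]`, the subalgebra generated
by `1` and `x`, with `x * y = 1`. -/
noncomputable def inv (x : J) : J :=
  if h : ∃ y ∈ NonUnitalAlgebra.adjoin ℝ ({1, x} : Set J), x * y = 1 then h.choose else 0

/-- The operation `x ⋆ y = P(x^{1/2}) y`. -/
noncomputable def star (x y : J) : J := quadRep (sqrt x) y

/-! ### Idempotents, Jordan frames, eigenvalues

These notions are also needed for the Jordan algebras `J(c, 1)` with `c` an idempotent of `J`, so
they are stated for a subspace `S` with the product inherited from `J`; `S = ⊤` gives `J`. -/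

/-- Idempotents are understood to be non-zero. -/
def IsIdempotent (c : J) : Prop := c ≠ 0 ∧ c * c = c

/-- `c` is a primitive idempotent of `S`: it is not the sum of two idempotents of `S`. -/
def IsPrimitive (S : Submodule ℝ J) (c : J) : Prop :=
  c ∈ S ∧ IsIdempotent c ∧
    ¬ ∃ a ∈ S, ∃ b ∈ S, IsIdempotent a ∧ IsIdempotent b ∧ a + b = c

/-- `c₁, …, c_r` is a Jordan frame of `S`: a maximal system of pairwise orthogonal primitive
idempotents. -/
def IsJordanFrame (S : Submodule ℝ J) {r : ℕ} (c : Fin r → J) : Prop :=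
  (∀ i, IsPrimitive S (c i)) ∧ (∀ i j, i ≠ j → c i * c j = 0) ∧
    ¬ ∃ d, IsPrimitive S d ∧ ∀ i, d * c i = 0

/-- `s` is the multiset of the coefficients of `x` with respect to some Jordan frame of `S`. -/
def IsSpectrum (S : Submodule ℝ J) (x : J) (s : Multiset ℝ) : Prop :=
  ∃ (r : ℕ) (c : Fin r → J) (ξ : Fin r → ℝ), IsJordanFrame S c ∧ x = ∑ i, ξ i • c i ∧
    s = Finset.univ.val.map ξ

open Classical in
/-- The eigenvalues, with multiplicity, of `x` in the Jordan algebra `S`. -/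
noncomputable def eigenvalues (S : Submodule ℝ J) (x : J) : Multiset ℝ :=
  if h : ∃ s, IsSpectrum S x s then h.choose else 0

/-- The determinant of `x` in the Jordan algebra `S`: the product of the eigenvalues. -/
noncomputable def det (S : Submodule ℝ J) (x : J) : ℝ := (eigenvalues S x).prod

/-- The trace of `x` in the Jordan algebra `S`: the sum of the eigenvalues. -/
noncomputable def tr (S : Submodule ℝ J) (x : J) : ℝ := (eigenvalues S x).sum

/-! ### The groups `G` and `K` -/

variable (J) in
/-- The automorphism group `G(Ω) = {g ∈ GL(J) : g Ω = Ω}`, as a subgroup of the topological group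
of invertible (continuous) linear maps. -/
def coneAut : Subgroup (J →L[ℝ] J)ˣ := MulAction.stabilizer (J →L[ℝ] J)ˣ (cone J)

variable (J) in
/-- The group `G`: the connected component of the identity in `G(Ω)`. -/
noncomputable def groupG : Subgroup (J →L[ℝ] J)ˣ :=
  (Subgroup.connectedComponentOfOne (coneAut J)).map (coneAut J).subtype

variable (J) in
/-- The group `K`: the stabilizer of the identity element in `G`. -/
noncomputable def groupK : Subgroup (J →L[ℝ] J)ˣ := groupG J ⊓ MulAction.stabilizer (J →L[ℝ] J)ˣ (1 : J)

/-- `f` is `K`-invariant on the cone. -/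
def IsKInvariant {α : Type*} (f : cone J → α) : Prop :=
  ∀ k ∈ groupK J, ∀ x y : cone J, k • (x : J) = y → f y = f x

end Basic

/-! ### Compactness of `K` -/

section Compact

variable {J : Type*} [EuclideanJordanAlgebra J]

lemma inner_sq_one (u : J) : inner ℝ (u * u) 1 = ‖u‖ ^ 2 := by
  rw [inner_mul_assoc, mul_one, real_inner_self_eq_norm_sq]

lemma continuous_units_smul (x : J) : Continuous fun g : (J →L[ℝ] J)ˣ => g • x :=
  (ContinuousLinearMap.apply ℝ J x).continuous.comp Units.continuous_val

lemma smul_mem_cone {g : (J →L[ℝ] J)ˣ} (hg : g ∈ groupG J) {x : J} (hx : x ∈ cone J) :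
    g • x ∈ cone J := by
  obtain ⟨a, -, rfl⟩ := hg
  have h : (a : (J →L[ℝ] J)ˣ) • cone J = cone J := a.2
  exact h ▸ Set.smul_mem_smul_set hx

variable [FiniteDimensional ℝ J]

variable (J) in
/-- The product as a continuous bilinear map. -/
noncomputable def mulL : J →L[ℝ] J →L[ℝ] J :=
  LinearMap.toContinuousLinearMap
    (LinearMap.toContinuousLinearMap.toLinearMap ∘ₗ LinearMap.mul ℝ J)

lemma mulL_apply (x y : J) : mulL J x y = x * y := rfl

lemma continuous_sq : Continuous fun x : J => x * x := by
  have : (fun x : J => x * x) = fun x => mulL J x x := rfl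
  rw [this]
  fun_prop

lemma isClosed_squares : IsClosed (squares J) := by
  have : ProperSpace J := FiniteDimensional.proper ℝ J
  have hbd : Filter.Tendsto (fun u : J => u * u) (Filter.cocompact J) (Filter.cocompact J) := by
    rw [← Metric.cobounded_eq_cocompact, ← tendsto_norm_atTop_iff_cobounded,
      Metric.cobounded_eq_cocompact]
    have h1 : Filter.Tendsto (fun u : J => ‖u‖ ^ 2) (Filter.cocompact J) Filter.atTop :=
      (Filter.tendsto_pow_atTop two_ne_zero).comp (tendsto_norm_cocompact_atTop)
    have h2 : ∀ u : J, ‖u‖ ^ 2 ≤ ‖u * u‖ * (‖(1 : J)‖ + 1) := fun u => by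
      rw [← inner_sq_one]
      refine (real_inner_le_norm _ _).trans ?_
      gcongr
      linarith
    have h3 := Filter.tendsto_atTop_mono h2 h1
    have h4 : (0 : ℝ) < ‖(1 : J)‖ + 1 := by positivity
    exact (Filter.tendsto_mul_const_atTop_of_pos h4).1 h3
  have hp : IsProperMap fun u : J => u * u :=
    isProperMap_iff_tendsto_cocompact.2 ⟨continuous_sq, hbd⟩
  exact hp.isClosedMap.isClosed_range

lemma one_mem_cone : (1 : J) ∈ cone J := by
  have : CompleteSpace J := FiniteDimensional.complete ℝ J
  have hd : HasStrictFDerivAt (fun x : J => x * x) ((2 : ℝ) • ContinuousLinearMap.id ℝ J) 1 := by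
    have h := (mulL J).isBoundedBilinearMap.hasStrictFDerivAt ((1 : J), (1 : J))
    have h' := HasStrictFDerivAt.comp (f := fun x : J => (x, x)) (1 : J) h
      ((hasStrictFDerivAt_id (𝕜 := ℝ) (1 : J)).prodMk (hasStrictFDerivAt_id (𝕜 := ℝ) (1 : J)))
    refine h'.congr_fderiv ?_
    ext v
    simp [mulL_apply, two_smul]
  have hm := hd.map_nhds_eq_of_surj (by
    refine LinearMap.range_eq_top.2 fun v => ⟨(2 : ℝ)⁻¹ • v, ?_⟩
    simp [smul_smul])
  rw [cone, mem_interior_iff_mem_nhds]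
  have : squares J ∈ Filter.map (fun x : J => x * x) (nhds 1) :=
    Filter.mem_map.2 (Filter.Eventually.of_forall fun x => ⟨x, rfl⟩)
  rwa [hm, mul_one] at this

lemma isClosed_coneAut : IsClosed (coneAut J : Set (J →L[ℝ] J)ˣ) := by
  have key : ∀ g ∈ (coneAut J).topologicalClosure, g • cone J ⊆ cone J := by
    intro g hg
    have h1 : g • cone J ⊆ squares J := by
      rintro _ ⟨x, hx, rfl⟩
      have hc : IsClosed {g : (J →L[ℝ] J)ˣ | g • x ∈ squares J} :=
        isClosed_squares.preimage (continuous_units_smul x)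
      refine closure_minimal ?_ hc hg
      intro g' hg'
      have h' : g' • cone J = cone J := hg'
      have : g' • x ∈ cone J := h' ▸ Set.smul_mem_smul_set hx
      exact (interior_subset : cone J ⊆ squares J) this
    refine interior_maximal h1 ?_
    have he : g • cone J = (fun x => g⁻¹ • x) ⁻¹' cone J := by
      rw [Set.preimage_smul, inv_inv]
    rw [he]
    exact isOpen_interior.preimage ((g⁻¹ : (J →L[ℝ] J)ˣ) : J →L[ℝ] J).continuous
  have hle : (coneAut J).topologicalClosure ≤ coneAut J := by
    intro g hg
    have h1 := key g hg
    have h2 := key g⁻¹ (inv_mem hg)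
    refine MulAction.mem_stabilizer_iff.2 (Set.Subset.antisymm h1 ?_)
    rwa [Set.subset_smul_set_iff]
  have := Subgroup.isClosed_topologicalClosure (coneAut J)
  rwa [le_antisymm hle (Subgroup.le_topologicalClosure _)] at this

lemma isClosed_groupK : IsClosed (groupK J : Set (J →L[ℝ] J)ˣ) := by
  rw [groupK, Subgroup.coe_inf]
  refine IsClosed.inter ?_ ?_
  · rw [groupG, Subgroup.coe_map]
    exact isClosed_coneAut.isClosedEmbedding_subtypeVal.isClosedMap _ isClosed_connectedComponent
  · exact isClosed_singleton.preimage (continuous_units_smul (1 : J))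

variable (J) in
lemma exists_norm_bound : ∃ R : ℝ, ∀ k ∈ groupK J, ‖(k : J →L[ℝ] J)‖ ≤ R := by
  obtain ⟨ε, hε, hball⟩ := Metric.isOpen_iff.1 (isOpen_interior (s := squares J)) 1 one_mem_cone
  have hb : ∀ z : J, 1 + z ∈ squares J → 1 - z ∈ squares J →
      ‖z‖ ≤ ‖mulL J‖ * (2 * ‖(1 : J)‖ ^ 2) + ‖(1 : J)‖ := by
    rintro z ⟨u, hu⟩ ⟨v, hv⟩
    have hu : u * u = 1 + z := hu
    have hv : v * v = 1 - z := hv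
    have h1 : ‖u‖ ^ 2 + ‖v‖ ^ 2 = 2 * ‖(1 : J)‖ ^ 2 := by
      rw [← inner_sq_one, ← inner_sq_one, hu, hv, ← inner_add_left,
        ← real_inner_self_eq_norm_sq, ← real_inner_smul_left]
      congr 1
      rw [two_smul]
      abel
    have h2 : ‖u * u‖ ≤ ‖mulL J‖ * ‖u‖ ^ 2 := by
      have := (mulL J).le_opNorm₂ u u
      rw [mulL_apply] at this
      linarith
    have h3 : z = u * u - 1 := by rw [hu]; abel
    have h4 : ‖z‖ ≤ ‖u * u‖ + ‖(1 : J)‖ := by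
      rw [h3]
      exact norm_sub_le _ _
    have h5 : ‖u‖ ^ 2 ≤ 2 * ‖(1 : J)‖ ^ 2 := by nlinarith [sq_nonneg ‖v‖]
    have h6 : ‖mulL J‖ * ‖u‖ ^ 2 ≤ ‖mulL J‖ * (2 * ‖(1 : J)‖ ^ 2) := by gcongr
    linarith
  set R := ‖mulL J‖ * (2 * ‖(1 : J)‖ ^ 2) + ‖(1 : J)‖ with hR
  have hR0 : 0 ≤ R := by positivity
  refine ⟨R / (ε / 2), fun k hk => ContinuousLinearMap.opNorm_le_bound _ (by positivity) ?_⟩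
  intro x
  have hk1 : k • (1 : J) = 1 := hk.2
  have hsmall : ∀ y : J, ‖y‖ < ε → ‖(k : J →L[ℝ] J) y‖ ≤ R := by
    intro y hy
    refine hb _ ?_ ?_
    · have : k • (1 + y) ∈ cone J := smul_mem_cone hk.1 (hball (by simpa using hy))
      rw [smul_add, hk1] at this
      exact interior_subset this
    · have : k • (1 - y) ∈ cone J := smul_mem_cone hk.1 (hball (by simpa using hy))
      rw [smul_sub, hk1] at this
      exact interior_subset this
  rcases eq_or_ne x 0 with rfl | hx
  · simp
  have hx' : 0 < ‖x‖ := norm_pos_iff.2 hx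
  have h := hsmall ((ε / 2 / ‖x‖) • x) (by
    rw [norm_smul, Real.norm_of_nonneg (by positivity), div_mul_cancel₀ _ hx'.ne']
    linarith)
  rw [map_smul, norm_smul, Real.norm_of_nonneg (by positivity)] at h
  have h2 : ‖(k : J →L[ℝ] J) x‖ = (ε / 2 / ‖x‖ * ‖(k : J →L[ℝ] J) x‖) / (ε / 2) * ‖x‖ := by
    field_simp
  rw [h2]
  gcongr

instance : CompactSpace (groupK J) := by
  have : CompleteSpace J := FiniteDimensional.complete ℝ J
  have : ProperSpace (J →L[ℝ] J) := FiniteDimensional.proper ℝ _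
  obtain ⟨R, hR⟩ := exists_norm_bound J
  have hB : IsCompact (Metric.closedBall (0 : J →L[ℝ] J) R) := isCompact_closedBall 0 R
  have hc := Units.isClosedEmbedding_embedProduct.isCompact_preimage
    (hB.prod (hB.image MulOpposite.continuous_op))
  refine isCompact_iff_compactSpace.1 (hc.of_isClosed_subset isClosed_groupK ?_)
  intro k hk
  exact ⟨mem_closedBall_zero_iff.2 (hR k hk),
    Set.mem_image_of_mem _ (mem_closedBall_zero_iff.2 (hR k⁻¹ (inv_mem hk)))⟩

end Compact

/-! ### Zonal polynomials

Throughout, `c : Fin r → J` is the fixed Jordan frame `c₁, …, c_r` of `J`. -/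

section Zonal

variable {J : Type*} [EuclideanJordanAlgebra J]

/-- For an idempotent `c`, the eigenspace `J(c, 1)` of `L(c)` for the eigenvalue `1`. -/
def peirceOne (c : J) : Submodule ℝ J where
  carrier := {x | c * x = x}
  add_mem' {x y} hx hy := by
    rw [Set.mem_ofPred_eq] at *
    rw [mul_add, hx, hy]
  zero_mem' := mul_zero c
  smul_mem' a x hx := by
    rw [Set.mem_ofPred_eq] at *
    rw [mul_smul_comm, hx]

/-- The successive differences `s_j - s_{j+1}`, with the convention `s_{r+1} = 0`. -/
def differences {R : Type*} [Sub R] {r : ℕ} (s : Fin r → R) (j : Fin r) : R :=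
  if h : (j : ℕ) + 1 < r then s j - s ⟨j + 1, h⟩ else s j

variable [FiniteDimensional ℝ J] {r : ℕ}

/-- The principal minor `Δ_j(x)`: the determinant, in the Jordan algebra `J(e_j, 1)` with
`e_j = c₁ + ⋯ + c_j`, of the orthogonal projection of `x`. -/
noncomputable def minor (c : Fin r → J) (j : Fin r) (x : J) : ℝ :=
  let S := peirceOne (∑ i ∈ Finset.Iic j, c i)
  det S (S.starProjection x)

/-- `Δ_l = ∏ Δ_j ^ (l_j - l_{j+1})` for a partition `l₁ ≥ ⋯ ≥ l_r`. -/
noncomputable def delta (c : Fin r → J) (l : Fin r → ℕ) (x : J) : ℝ :=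
  ∏ j, minor c j x ^ differences l j

/-- `Δ_s = ∏ Δ_j ^ (s_j - s_{j+1})` for real exponents (used on `Ω`, where `Δ_j > 0`). -/
noncomputable def deltaR (c : Fin r → J) (s : Fin r → ℝ) (x : J) : ℝ :=
  ∏ j, minor c j x ^ differences s j

/-- The gamma function `Γ_Ω(s) = ∫_Ω e^{-tr x} Δ_s(x) det(x)^{-n/r} dx`, at real `s`, with
`n = dim J`. -/
noncomputable def gamma (c : Fin r → J) (s : Fin r → ℝ) : ℝ :=
  letI : MeasurableSpace J := borel J
  haveI : BorelSpace J := ⟨rfl⟩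
  ∫ x in cone J, Real.exp (-tr ⊤ x) * deltaR c s x *
    det ⊤ x ^ (-((Module.finrank ℝ J : ℝ) / r))

/-- The Pochhammer symbol `(s)_l = Γ_Ω(s + l) / Γ_Ω(s)`. -/
noncomputable def pochhammer (c : Fin r → J) (s : ℝ) (l : Fin r → ℕ) : ℝ :=
  gamma c (fun j => s + l j) / gamma c (fun _ => s)

variable (J) in
/-- The normalized Haar measure of `K`, on its Borel sets. -/
noncomputable def haarK : @MeasureTheory.Measure (groupK J) (borel (groupK J)) :=
  letI : MeasurableSpace (groupK J) := borel (groupK J)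
  haveI : BorelSpace (groupK J) := ⟨rfl⟩
  MeasureTheory.Measure.haarMeasure ⊤

/-- The spherical polynomial `Φ_l(x) = ∫_K Δ_l(k x) dk`. -/
noncomputable def spherical (c : Fin r → J) (l : Fin r → ℕ) (x : J) : ℝ :=
  letI : MeasurableSpace (groupK J) := borel (groupK J)
  ∫ k : groupK J, delta c l ((k : (J →L[ℝ] J)ˣ) • x) ∂(haarK J)

/-- The space `𝒫_l(J)` spanned by the functions `g Δ_l : x ↦ Δ_l(g⁻¹ x)`, `g ∈ G`. -/
def polySpace (c : Fin r → J) (l : Fin r → ℕ) : Submodule ℝ (J → ℝ) :=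
  Submodule.span ℝ {p | ∃ g ∈ groupG J, p = fun x => delta c l (g⁻¹ • x)}

/-- The zonal polynomial `Z_l = d_l · |l|! / (n/r)_l · Φ_l` with `d_l = dim 𝒫_l(J)`. -/
noncomputable def zonal (c : Fin r → J) (l : Fin r → ℕ) (x : J) : ℝ :=
  (Module.finrank ℝ (polySpace c l) : ℝ) *
    ((Nat.factorial (∑ j, l j) : ℝ) / pochhammer c ((Module.finrank ℝ J : ℝ) / r) l) *
    spherical c l x

end Zonal

end EuclideanJordanAlgebra

/-! Write `A`, `B`, `C` for the quadratic representations of the square roots of `x`, `y`, `x ⋆ y`.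
The fundamental formula `P(P(a)b) = P(a)P(b)P(a)` gives `C² = AB²A`. Hence `k = C⁻¹AB` fixes `1` and
sends `y ⋆ x = BA1` to `C1 = x ⋆ y`. Each factor is of the form `exp (2L(z))`, which a path in the
automorphism group of the cone joins to the identity, so `k ∈ K`. The same formula makes `k` respect
squares, so it is a Jordan automorphism (`exists_groupK_smul_star`). This gives equality of
eigenvalues, of `K`-invariant functions and of zonal polynomials.

The fundamental formula is needed only on the cone and, by closure, on squares. It comes from
`quadL_exp_apply`, obtained by differentiating along `exp (tL(x))`. This and part (a) rest on the
spectral theorem `exists_jordanFrame`, which makes square roots, inverses and logarithms act on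
coefficients.

For the trace and the determinant, simplicity enters through `IsPrimitive.apply_eq`: an associative
functional is constant on primitive idempotents, hence a multiple of `tr`. The inner product with
`1` then gives the trace formula. The functional `Tr L` expresses the operator determinant of `P(x)`
as a power of `det x`, so the fundamental formula makes `det` multiplicative for `⋆`. -/

namespace EuclideanJordanAlgebra

/-! ### Linearized Jordan identities and positivity of idempotents -/

section Algebra

variable {J : Type*} [EuclideanJordanAlgebra J]

/-- The fully linearized Jordan identity. -/
lemma jordan_linearized (a b c w : J) :
    a * ((b * c) * w) + b * ((c * a) * w) + c * ((a * b) * w) =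
      (b * c) * (a * w) + (c * a) * (b * w) + (a * b) * (c * w) := by
  have h : (2 : ℕ) • (a * ((b * c) * w) - (b * c) * (a * w) + (b * ((c * a) * w) -
      (c * a) * (b * w)) + (c * ((a * b) * w) - (a * b) * (c * w))) = 0 :=
    DFunLike.congr_fun (two_nsmul_lie_lmul_lmul_add_add_eq_zero a b c) w
  have h2 : (2 : ℝ) • (a * ((b * c) * w) + b * ((c * a) * w) + c * ((a * b) * w) -
      ((b * c) * (a * w) + (c * a) * (b * w) + (a * b) * (c * w))) = 0 := by
    rw [← h]
    module
  exact sub_eq_zero.1 ((smul_eq_zero.1 h2).resolve_left two_ne_zero)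

lemma mul_sq_mul_add (x y w : J) :
    (x * x * y) * w + (2 : ℝ) • (x * (y * (x * w))) =
      x * x * (y * w) + (2 : ℝ) • (x * y * (x * w)) := by
  have h := jordan_linearized x x w y
  simp only [mul_comm] at h ⊢
  linear_combination (norm := module) h

/-- `[L(x), L(y)]` is a derivation. -/
lemma commutator_derivation (x y z w : J) :
    x * (y * (z * w)) - y * (x * (z * w)) - (z * (x * (y * w)) - z * (y * (x * w))) =
      (x * (y * z) - y * (x * z)) * w := by
  have h1 := jordan_linearized x z w y
  have h2 := jordan_linearized y z w x
  rw [sub_mul]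
  simp only [mul_comm] at h1 h2 ⊢
  linear_combination (norm := module) h1 - h2

/-- The identity `2 P(xy, y) = L(x) P(y) + P(y) L(x)`. -/
lemma quadRep_polar_mul (x y w : J) :
    (2 : ℝ) • (x * y * (y * w) + y * (x * y * w) - (x * y * y) * w) =
      x * ((2 : ℝ) • (y * (y * w)) - y * y * w) +
        ((2 : ℝ) • (y * (y * (x * w))) - y * y * (x * w)) := by
  have h1 := jordan_linearized x y y w
  have h2 := jordan_linearized x y w y
  rw [mul_sub, mul_smul_comm]
  simp only [mul_comm] at h1 h2 ⊢
  linear_combination (norm := module) h1 - (2 : ℝ) • h2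

/-- The Peirce polynomial: `L(p)` is a root of `t(2t - 1)(t - 1)`, so its only possible eigenvalues
are `0`, `1/2`, `1`. -/
lemma mul_mul_mul_idempotent {p : J} (hp : p * p = p) (w : J) :
    (2 : ℝ) • (p * (p * (p * w))) = (3 : ℝ) • (p * (p * w)) - p * w := by
  have h := mul_sq_mul_add p p w
  simp only [hp] at h
  linear_combination (norm := module) h

lemma quadRep_apply (x y : J) : quadRep x y = (2 : ℝ) • (x * (x * y)) - x * x * y := rfl

lemma inner_mul_comm (x y z : J) : inner ℝ (x * y) z = inner ℝ y (x * z) := by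
  rw [mul_comm, inner_mul_assoc]

lemma quadRep_one_right (x : J) : quadRep x 1 = x * x := by
  rw [quadRep_apply, mul_one, mul_one]; module

lemma quadRep_one_left (x : J) : quadRep 1 x = x := by
  simp only [quadRep_apply, one_mul]; module

lemma inner_quadRep (x y z : J) : inner ℝ (quadRep x y) z = inner ℝ y (quadRep x z) := by
  simp only [quadRep_apply, inner_sub_left, inner_sub_right, real_inner_smul_left,
    real_inner_smul_right, inner_mul_comm]

/-! ### Idempotents -/

/-- On the Peirce eigenvalues `0`, `1/2`, `1` one has `t = t² + 4(t - t²)²`. Since `L(p)` is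
symmetric, this turns its quadratic form into a sum of squares. -/
lemma inner_mul_self_idempotent {p : J} (hp : p * p = p) (v : J) :
    inner ℝ (p * v) v = ‖p * v‖ ^ 2 + 4 * ‖p * v - p * (p * v)‖ ^ 2 := by
  have key : p * v = p * (p * v) + (4 : ℝ) • (p * (p * v - p * (p * v)) -
      p * (p * (p * v - p * (p * v)))) := by
    have h1 := mul_mul_mul_idempotent hp v
    have h2 : (2 : ℝ) • (p * (p * (p * (p * v)))) = (3 : ℝ) • (p * (p * (p * v))) - p * (p * v) :=
      mul_mul_mul_idempotent hp (p * v)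
    simp only [mul_sub]
    linear_combination (norm := module) (1 : ℝ) • h1 - (2 : ℝ) • h2
  have h3 : inner ℝ (p * (p * v)) v = ‖p * v‖ ^ 2 := by
    rw [inner_mul_comm, real_inner_self_eq_norm_sq]
  have h4 : inner ℝ (p * (p * v - p * (p * v)) - p * (p * (p * v - p * (p * v)))) v =
      ‖p * v - p * (p * v)‖ ^ 2 := by
    rw [inner_sub_left, inner_mul_comm, inner_mul_comm p, inner_mul_comm p, ← inner_sub_right,
      real_inner_self_eq_norm_sq]
  conv_lhs => rw [key]
  rw [inner_add_left, real_inner_smul_left, h3, h4]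

lemma inner_mul_self_nonneg {p : J} (hp : p * p = p) (v : J) : 0 ≤ inner ℝ (p * v) v := by
  rw [inner_mul_self_idempotent hp]; positivity

lemma inner_sq_idempotent (p u : J) : inner ℝ p (u * u) = inner ℝ (p * u) u :=
  (inner_mul_assoc p u u).symm

lemma inner_idempotent_nonneg {p q : J} (hp : p * p = p) (hq : q * q = q) : 0 ≤ inner ℝ p q := by
  rw [← hq, inner_sq_idempotent]; exact inner_mul_self_nonneg hp q

/-- The inner product equals `⟨pq, q⟩`, which dominates `‖pq‖²`. -/
lemma mul_eq_zero_of_inner_eq_zero {p q : J} (hp : p * p = p) (hq : q * q = q)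
    (h : inner ℝ p q = 0) : p * q = 0 := by
  rw [← hq, inner_sq_idempotent, inner_mul_self_idempotent hp] at h
  have : ‖p * q‖ ^ 2 = 0 := le_antisymm (by nlinarith [sq_nonneg ‖p * q - p * (p * q)‖])
    (sq_nonneg _)
  simpa using this

lemma inner_eq_zero_of_mul_eq_zero {p q : J} (hq : q * q = q)
    (h : p * q = 0) : inner ℝ p q = 0 := by
  rw [← hq, inner_sq_idempotent, h, inner_zero_left]

/-- Inner products of idempotents are nonnegative, so a vanishing sum of two of them vanishes
termwise. -/
lemma mul_eq_zero_of_add {a b p : J} (ha : a * a = a) (hb : b * b = b) (hp : p * p = p)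
    (h : (a + b) * p = 0) : a * p = 0 := by
  refine mul_eq_zero_of_inner_eq_zero ha hp (le_antisymm ?_ (inner_idempotent_nonneg ha hp))
  have := inner_eq_zero_of_mul_eq_zero hp h
  rw [inner_add_left] at this
  linarith [inner_idempotent_nonneg hb hp]

lemma mul_eq_zero_of_add_idempotent {a b : J} (ha : a * a = a) (hb : b * b = b)
    (h : (a + b) * (a + b) = a + b) : a * b = 0 := by
  have : (2 : ℝ) • (a * b) = 0 := by
    simp only [add_mul, mul_add, ha, hb, mul_comm b a] at h
    linear_combination (norm := module) h
  exact (smul_eq_zero.1 this).resolve_left two_ne_zero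

lemma sub_mul_sub_idempotent {a p : J} (ha : a * a = a) (hp : p * p = p) (h : p * a = a) :
    (p - a) * (p - a) = p - a := by
  simp only [sub_mul, mul_sub, ha, hp, h, mul_comm a p]; abel

end Algebra

/-! ### Power associativity and polynomials in one element -/

section Calculus

open Polynomial

variable {J : Type*} [EuclideanJordanAlgebra J] [FiniteDimensional ℝ J]

/-- The value at `x` of the polynomial `f`. -/
noncomputable def polyEval (x : J) (f : ℝ[X]) : J := aeval (mulL J x) f 1

lemma polyEval_add (x : J) (f g : ℝ[X]) : polyEval x (f + g) = polyEval x f + polyEval x g := by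
  simp [polyEval]

lemma polyEval_smul (x : J) (a : ℝ) (f : ℝ[X]) : polyEval x (a • f) = a • polyEval x f := by
  simp [polyEval]

lemma polyEval_one (x : J) : polyEval x 1 = 1 := by simp [polyEval]

lemma polyEval_X (x : J) : polyEval x X = x := by simp [polyEval, mulL_apply]

lemma polyEval_mul_eq_aeval (x : J) (f g : ℝ[X]) :
    polyEval x (f * g) = aeval (mulL J x) f (polyEval x g) := by
  simp [polyEval]

lemma polyEval_X_mul (x : J) (f : ℝ[X]) : polyEval x (X * f) = x * polyEval x f := by
  simp [polyEval_mul_eq_aeval, mulL_apply]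

lemma commute_mulL_sq (x : J) : Commute (mulL J (x * x)) (mulL J x) := by
  ext w
  have h := jordan_linearized x x x w
  simp only [mul_apply_eq_comp, mulL_apply]
  have h2 : (3 : ℝ) • (x * x * (x * w)) = (3 : ℝ) • (x * (x * x * w)) := by
    linear_combination (norm := module) -h
  exact smul_right_injective J (three_ne_zero) h2

lemma mulL_sq_mul (x y : J) : mulL J (x * x * y) = mulL J (x * x) * mulL J y +
    (2 : ℝ) • (mulL J (x * y) * mulL J x) - (2 : ℝ) • (mulL J x * mulL J y * mulL J x) := by
  ext w
  have h := mul_sq_mul_add x y w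
  simp only [mul_apply_eq_comp, mulL_apply, add_apply,
    sub_apply, smul_apply]
  linear_combination (norm := module) h

/-- The core of power associativity. `mulL_sq_mul` with `y = xⁿ` expresses `L(xⁿ⁺²)` through `L(x)`,
`L(x²)`, `L(xⁿ)` and `L(xⁿ⁺¹)`, whence the two-step induction. -/
lemma commute_mulL_pow (x : J) (n : ℕ) : Commute (mulL J (polyEval x (X ^ n))) (mulL J x) := by
  induction n using Nat.strong_induction_on with
  | _ n ih =>
    match n, ih with
    | 0, _ =>
      rw [pow_zero, polyEval_one]
      ext w; simp [mulL_apply]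
    | 1, _ => rw [pow_one, polyEval_X]
    | n + 2, ih =>
      have h1 := ih n (by omega)
      have h2 := ih (n + 1) (by omega)
      have e1 : polyEval x (X ^ (n + 1)) = x * polyEval x (X ^ n) := by
        rw [pow_succ', polyEval_X_mul]
      have e2 : polyEval x (X ^ (n + 2)) = x * x * polyEval x (X ^ n) := by
        have h : Commute (mulL J (x * x)) (aeval (mulL J x) (X ^ n : ℝ[X])) := by
          rw [map_pow, aeval_X]
          exact (commute_mulL_sq x).pow_right n
        have h' := DFunLike.congr_fun h.eq 1
        simp only [mul_apply_eq_comp, mulL_apply, mul_one] at h'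
        rw [polyEval, polyEval, h', pow_add, map_mul, mul_apply_eq_comp]
        simp [pow_two, mulL_apply]
      rw [e2, mulL_sq_mul, ← e1]
      have hs := commute_mulL_sq x
      have hx : Commute (mulL J x) (mulL J x) := Commute.refl _
      exact ((hs.mul_left h1).add_left ((h2.mul_left hx).smul_left _)).sub_left
        (((hx.mul_left h1).mul_left hx).smul_left _)

lemma commute_mulL_polyEval (x : J) (f : ℝ[X]) : Commute (mulL J (polyEval x f)) (mulL J x) := by
  induction f using Polynomial.induction_on' with
  | add p q hp hq => rw [polyEval_add, map_add]; exact hp.add_left hq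
  | monomial n a =>
    rw [← C_mul_X_pow_eq_monomial, ← smul_eq_C_mul, polyEval_smul, map_smul]
    exact (commute_mulL_pow x n).smul_left a

lemma polyEval_mul (x : J) (f g : ℝ[X]) : polyEval x (f * g) = polyEval x f * polyEval x g := by
  have h : Commute (mulL J (polyEval x f)) (aeval (mulL J x) g) := by
    induction g using Polynomial.induction_on' with
    | add p q hp hq => rw [map_add]; exact hp.add_right hq
    | monomial n a =>
      rw [← C_mul_X_pow_eq_monomial, ← smul_eq_C_mul, map_smul, map_pow, aeval_X]
      exact ((commute_mulL_polyEval x f).pow_right n).smul_right a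
  have h' := DFunLike.congr_fun h.eq 1
  simp only [mul_apply_eq_comp, mulL_apply, mul_one] at h'
  rw [mul_comm f g, polyEval_mul_eq_aeval, ← h']
  rfl

lemma polyEval_mem_adjoin (x : J) (f : ℝ[X]) :
    polyEval x f ∈ NonUnitalAlgebra.adjoin ℝ ({1, x} : Set J) := by
  have h1 : (1 : J) ∈ NonUnitalAlgebra.adjoin ℝ ({1, x} : Set J) :=
    NonUnitalAlgebra.subset_adjoin ℝ (by simp)
  have hx : x ∈ NonUnitalAlgebra.adjoin ℝ ({1, x} : Set J) :=
    NonUnitalAlgebra.subset_adjoin ℝ (by simp)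
  induction f using Polynomial.induction_on' with
  | add p q hp hq => rw [polyEval_add]; exact add_mem hp hq
  | monomial n a =>
    rw [← C_mul_X_pow_eq_monomial, ← smul_eq_C_mul, polyEval_smul]
    refine SMulMemClass.smul_mem a ?_
    induction n with
    | zero => rwa [pow_zero, polyEval_one]
    | succ n ih => rw [pow_succ', polyEval_X_mul]; exact mul_mem hx ih

lemma exists_polyEval_of_mem_adjoin {x y : J}
    (hy : y ∈ NonUnitalAlgebra.adjoin ℝ ({1, x} : Set J)) : ∃ f : ℝ[X], polyEval x f = y := by
  induction hy using NonUnitalAlgebra.adjoin_induction with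
  | mem y hy =>
    rcases hy with rfl | rfl
    · exact ⟨1, polyEval_one x⟩
    · exact ⟨X, polyEval_X _⟩
  | add a b _ _ ha hb =>
    obtain ⟨f, rfl⟩ := ha
    obtain ⟨g, rfl⟩ := hb
    exact ⟨f + g, polyEval_add x f g⟩
  | zero => exact ⟨0, by simp [polyEval]⟩
  | mul a b _ _ ha hb =>
    obtain ⟨f, rfl⟩ := ha
    obtain ⟨g, rfl⟩ := hb
    exact ⟨f * g, polyEval_mul x f g⟩
  | smul a b _ hb =>
    obtain ⟨f, rfl⟩ := hb
    exact ⟨a • f, polyEval_smul x a f⟩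

/-- Polynomials in `x` multiply associatively, so the inverse within `ℝ[x]` is unique and the choice
made in `inv` is harmless. -/
lemma inv_eq_polyEval {x : J} {f : ℝ[X]} (h : x * polyEval x f = 1) : inv x = polyEval x f := by
  have hex : ∃ y ∈ NonUnitalAlgebra.adjoin ℝ ({1, x} : Set J), x * y = 1 :=
    ⟨_, polyEval_mem_adjoin x f, h⟩
  rw [inv, dif_pos hex]
  obtain ⟨hm, h1⟩ := hex.choose_spec
  obtain ⟨g, hg⟩ := exists_polyEval_of_mem_adjoin hm
  rw [← hg] at h1 ⊢
  rw [← polyEval_X_mul] at h h1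
  calc polyEval x g = polyEval x g * polyEval x (X * f) := by rw [h, mul_one]
    _ = polyEval x (X * g) * polyEval x f := by
      rw [← polyEval_mul, ← polyEval_mul]; congr 1; ring
    _ = polyEval x f := by rw [h1, one_mul]

end Calculus

/-! ### Resolutions of the identity and functional calculus -/

section Resolution

open Polynomial

variable {J : Type*} [EuclideanJordanAlgebra J]

/-- A resolution of the identity: pairwise orthogonal (possibly zero) solutions of `p * p = p`
with sum `1`. -/
structure IsResolution {ι : Type*} [Fintype ι] (c : ι → J) : Prop where
  idem : ∀ i, c i * c i = c i
  orth : ∀ i j, i ≠ j → c i * c j = 0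
  sum_eq_one : ∑ i, c i = 1

namespace IsResolution

variable {ι : Type*} [Fintype ι] {c : ι → J}

lemma sum_smul_mul (h : IsResolution c) (ξ : ι → ℝ) (j : ι) :
    (∑ i, ξ i • c i) * c j = ξ j • c j := by
  classical
  rw [Finset.sum_mul, Finset.sum_eq_single j]
  · rw [smul_mul_assoc, h.idem]
  · intro i _ hi
    rw [smul_mul_assoc, h.orth i j hi, smul_zero]
  · simp

lemma sum_smul_mul_sum_smul (h : IsResolution c) (ξ η : ι → ℝ) :
    (∑ i, ξ i • c i) * ∑ i, η i • c i = ∑ i, (ξ i * η i) • c i := by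
  rw [Finset.mul_sum]
  refine Finset.sum_congr rfl fun i _ => ?_
  rw [mul_smul_comm, h.sum_smul_mul, smul_smul, mul_comm]

lemma quadRep_sum_smul (h : IsResolution c) (ξ η : ι → ℝ) :
    quadRep (∑ i, ξ i • c i) (∑ i, η i • c i) = ∑ i, (ξ i ^ 2 * η i) • c i := by
  rw [quadRep_apply]
  simp only [h.sum_smul_mul_sum_smul, Finset.smul_sum]
  rw [← Finset.sum_sub_distrib]
  refine Finset.sum_congr rfl fun i _ => ?_
  rw [smul_smul, ← sub_smul]
  congr 1
  ring

lemma quadRep_sum_smul_apply (h : IsResolution c) (ξ : ι → ℝ) (j : ι) :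
    quadRep (∑ i, ξ i • c i) (c j) = ξ j ^ 2 • c j := by
  rw [quadRep_apply, h.sum_smul_mul_sum_smul]
  simp only [h.sum_smul_mul, mul_smul_comm]
  module

lemma inner_sum_smul (h : IsResolution c) (ξ : ι → ℝ) (j : ι) :
    inner ℝ (∑ i, ξ i • c i) (c j) = ξ j * ‖c j‖ ^ 2 := by
  rw [← h.idem j, ← inner_mul_assoc, h.sum_smul_mul, real_inner_smul_left,
    real_inner_self_eq_norm_sq, h.idem]

/-- Pairing with `v` gives a positive combination of the nonnegative numbers `⟨cᵢv, v⟩`. Each must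
vanish, which forces `cᵢv = 0`. -/
lemma eq_zero_of_sum_smul_mul_eq_zero (h : IsResolution c) {ξ : ι → ℝ} (hξ : ∀ i, 0 < ξ i) {v : J}
    (hv : (∑ i, ξ i • c i) * v = 0) : v = 0 := by
  have h0 : ∑ i, ξ i * inner ℝ (c i * v) v = 0 := by
    rw [Finset.sum_mul] at hv
    simpa [sum_inner, smul_mul_assoc, real_inner_smul_left] using congrArg (inner ℝ · v) hv
  have hnn : ∀ i, 0 ≤ inner ℝ (c i * v) v := fun i => inner_mul_self_nonneg (h.idem i) v
  rw [Finset.sum_eq_zero_iff_of_nonneg fun i _ => mul_nonneg (hξ i).le (hnn i)] at h0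
  rw [← one_mul v, ← h.sum_eq_one, Finset.sum_mul]
  refine Finset.sum_eq_zero fun i hi => ?_
  have h1 := (mul_eq_zero.1 (h0 i hi)).resolve_left (hξ i).ne'
  rw [inner_mul_self_idempotent (h.idem i)] at h1
  have : ‖c i * v‖ ^ 2 = 0 := le_antisymm
    (by nlinarith [sq_nonneg ‖c i * v - c i * (c i * v)‖]) (sq_nonneg _)
  simpa using this

/-- Openness allows subtracting a small `t • c j` with `t > 0` and remaining a square. Squares pair
nonnegatively with idempotents, so `ξ j ≥ t`. -/
lemma pos_of_sum_smul_mem_cone (h : IsResolution c) {ξ : ι → ℝ}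
    (hx : ∑ i, ξ i • c i ∈ cone J) {j : ι} (hj : c j ≠ 0) : 0 < ξ j := by
  have hc : Continuous fun t : ℝ => (∑ i, ξ i • c i) - t • c j := by fun_prop
  have h0 : ∀ᶠ t in nhds (0 : ℝ), (∑ i, ξ i • c i) - t • c j ∈ cone J :=
    hc.continuousAt.eventually (isOpen_interior.mem_nhds (by simpa [cone] using hx))
  obtain ⟨t, ⟨u, hu⟩, ht⟩ := ((h0.filter_mono nhdsWithin_le_nhds).mono
    (fun t ht => interior_subset ht)).and (self_mem_nhdsWithin (s := Set.Ioi (0 : ℝ))) |>.exists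
  have hu : u * u = (∑ i, ξ i • c i) - t • c j := hu
  have h1 : 0 ≤ inner ℝ (c j) (u * u) := by
    rw [inner_sq_idempotent]
    exact inner_mul_self_nonneg (h.idem j) u
  rw [hu, real_inner_comm, inner_sub_left, h.inner_sum_smul, real_inner_smul_left,
    real_inner_self_eq_norm_sq, ← sub_mul] at h1
  have h2 : 0 < ‖c j‖ ^ 2 := by positivity
  have := nonneg_of_mul_nonneg_left h1 h2
  have ht : 0 < t := ht
  linarith

variable [FiniteDimensional ℝ J]

lemma polyEval_sum_smul (h : IsResolution c) (ξ : ι → ℝ) (f : ℝ[X]) :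
    polyEval (∑ i, ξ i • c i) f = ∑ i, f.eval (ξ i) • c i := by
  induction f using Polynomial.induction_on' with
  | add p q hp hq => simp only [polyEval_add, hp, hq, eval_add, add_smul, Finset.sum_add_distrib]
  | monomial n a =>
    rw [← C_mul_X_pow_eq_monomial, ← smul_eq_C_mul, polyEval_smul]
    simp only [eval_smul, eval_pow, eval_X, smul_eq_mul, mul_smul, ← Finset.smul_sum]
    congr 1
    induction n with
    | zero => simp [polyEval_one, h.sum_eq_one]
    | succ n ih =>
      rw [pow_succ', polyEval_X_mul, ih, h.sum_smul_mul_sum_smul]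
      simp only [pow_succ']

/-- The functional calculus does not depend on the resolution. -/
lemma sum_smul_congr (h : IsResolution c) {κ : Type*} [Fintype κ] {d : κ → J}
    (h' : IsResolution d) {ξ : ι → ℝ} {η : κ → ℝ} (hx : ∑ i, ξ i • c i = ∑ j, η j • d j)
    (φ : ℝ → ℝ) : ∑ i, φ (ξ i) • c i = ∑ j, φ (η j) • d j := by
  classical
  -- Interpolating `φ` at the coefficients of both expansions replaces it by one polynomial, whose
  -- value depends only on the element.
  set s : Finset ℝ := Finset.univ.image ξ ∪ Finset.univ.image η with hs
  have hf : ∀ t ∈ s, (Lagrange.interpolate s id φ).eval t = φ t := fun t ht =>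
    Lagrange.eval_interpolate_at_node (v := id) φ (Set.injOn_id _) ht
  have h1 := h.polyEval_sum_smul ξ (Lagrange.interpolate s id φ)
  rw [hx, h'.polyEval_sum_smul] at h1
  rw [Finset.sum_congr rfl fun i _ => by
      rw [← hf (ξ i) (Finset.mem_union_left _ (Finset.mem_image_of_mem _ (Finset.mem_univ i)))],
    ← h1]
  exact Finset.sum_congr rfl fun i _ => by
    rw [hf (η i) (Finset.mem_union_right _ (Finset.mem_image_of_mem _ (Finset.mem_univ i)))]

lemma inv_sum_smul (h : IsResolution c) {ξ : ι → ℝ} (hξ : ∀ i, ξ i ≠ 0) :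
    inv (∑ i, ξ i • c i) = ∑ i, (ξ i)⁻¹ • c i := by
  classical
  set s : Finset ℝ := Finset.univ.image ξ with hs
  have hf : ∀ t ∈ s, (Lagrange.interpolate s id (fun t => t⁻¹)).eval t = t⁻¹ := fun t ht =>
    Lagrange.eval_interpolate_at_node (v := id) _ (Set.injOn_id _) ht
  have h1 := h.polyEval_sum_smul ξ (Lagrange.interpolate s id (fun t => t⁻¹))
  simp only [fun i => hf (ξ i) (Finset.mem_image_of_mem _ (Finset.mem_univ i))] at h1
  rw [← h1]
  refine inv_eq_polyEval ?_
  rw [h1, h.sum_smul_mul_sum_smul, ← h.sum_eq_one]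
  exact Finset.sum_congr rfl fun i _ => by rw [mul_inv_cancel₀ (hξ i), one_smul]

/-- Squaring has derivative `2L(a)` at the square root `a`. This is injective, hence surjective, so
squaring is open at `a`. -/
lemma sum_smul_mem_cone (h : IsResolution c) {ξ : ι → ℝ} (hξ : ∀ i, 0 < ξ i) :
    ∑ i, ξ i • c i ∈ cone J := by
  have : CompleteSpace J := FiniteDimensional.complete ℝ J
  set a : J := ∑ i, √(ξ i) • c i with ha
  have haa : a * a = ∑ i, ξ i • c i := by
    rw [ha, h.sum_smul_mul_sum_smul]
    simp only [Real.mul_self_sqrt (hξ _).le]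
  have hd : HasStrictFDerivAt (fun x : J => x * x) ((2 : ℝ) • mulL J a) a := by
    have h := (mulL J).isBoundedBilinearMap.hasStrictFDerivAt (a, a)
    have h' := HasStrictFDerivAt.comp (f := fun x : J => (x, x)) a h
      ((hasStrictFDerivAt_id (𝕜 := ℝ) a).prodMk (hasStrictFDerivAt_id (𝕜 := ℝ) a))
    refine h'.congr_fderiv ?_
    ext v
    simp [mulL_apply, two_smul, mul_comm v a]
  have hinj : Function.Injective (((2 : ℝ) • mulL J a : J →L[ℝ] J) : J →ₗ[ℝ] J) := by
    rw [← LinearMap.ker_eq_bot, LinearMap.ker_eq_bot']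
    intro v hv
    refine h.eq_zero_of_sum_smul_mul_eq_zero (fun i => Real.sqrt_pos.2 (hξ i)) (v := v) ?_
    exact (smul_eq_zero.1 (show (2 : ℝ) • (a * v) = 0 from hv)).resolve_left two_ne_zero
  have hm := hd.map_nhds_eq_of_surj
    (LinearMap.range_eq_top.2 (LinearMap.injective_iff_surjective.1 hinj))
  rw [cone, mem_interior_iff_mem_nhds, ← haa]
  have : squares J ∈ Filter.map (fun x : J => x * x) (nhds a) :=
    Filter.mem_map.2 (Filter.Eventually.of_forall fun x => ⟨x, rfl⟩)
  rwa [hm] at this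

end IsResolution

variable [FiniteDimensional ℝ J]

/-- Decompose `1` along the eigenspaces of the symmetric operator `L(x)`. The components are
Lagrange basis polynomials evaluated at `x`, so they multiply as those polynomials do on the
spectrum. Some components may be zero. -/
lemma exists_resolution (x : J) : ∃ s : Finset ℝ, ∃ p : s → J, IsResolution p ∧
    x = ∑ i : s, (i : ℝ) • p i := by
  classical
  have hsym : (mulL J x : J →ₗ[ℝ] J).IsSymmetric := fun u v => inner_mul_comm x u v
  set b := hsym.eigenvectorBasis rfl
  set e := hsym.eigenvalues rfl
  have hb : ∀ i, x * b i = e i • b i := fun i => hsym.apply_eigenvectorBasis rfl i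
  set s : Finset ℝ := Finset.univ.image e with hs
  set p : s → J := fun l => ∑ i with e i = l, inner ℝ (b i) 1 • b i with hp
  have hxp : ∀ l : s, x * p l = (l : ℝ) • p l := by
    intro l
    simp only [hp]
    rw [Finset.mul_sum, Finset.smul_sum]
    refine Finset.sum_congr rfl fun i hi => ?_
    rw [mul_smul_comm, hb, (Finset.mem_filter.1 hi).2, smul_comm]
  have hsum : ∑ l, p l = 1 := by
    simp only [hp]
    rw [Finset.sum_coe_sort s (fun l => ∑ i with e i = l, inner ℝ (b i) 1 • b i),
      Finset.sum_fiberwise_of_maps_to (fun i hi => Finset.mem_image_of_mem _ hi)]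
    exact b.sum_repr' 1
  have haev : ∀ (f : ℝ[X]) (l : s), aeval (mulL J x) f (p l) = f.eval (l : ℝ) • p l := by
    intro f l
    induction f using Polynomial.induction_on' with
    | add p q hp hq => rw [map_add, add_apply, hp, hq, eval_add, add_smul]
    | monomial n a =>
      rw [← C_mul_X_pow_eq_monomial, ← smul_eq_C_mul, map_smul, smul_apply, eval_smul,
        smul_eq_mul, mul_smul, map_pow, aeval_X, eval_pow, eval_X]
      congr 1
      induction n with
      | zero => simp
      | succ n ih => rw [pow_succ', mul_apply_eq_comp, ih, map_smul, mulL_apply, hxp, smul_smul,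
          pow_succ]
  have hev : ∀ f : ℝ[X], polyEval x f = ∑ l : s, f.eval (l : ℝ) • p l := by
    intro f
    rw [polyEval, ← hsum, map_sum]
    exact Finset.sum_congr rfl fun l _ => haev f l
  have hL : ∀ l m : s, (Lagrange.basis s id (l : ℝ)).eval (m : ℝ) = if m = l then 1 else 0 := by
    intro l m
    split_ifs with hlm
    · rw [hlm]
      exact Lagrange.eval_basis_self (v := id) (Set.injOn_id _) l.2
    · exact Lagrange.eval_basis_of_ne (v := id) (fun h => hlm (Subtype.ext h.symm)) m.2
  have hpl : ∀ l : s, p l = polyEval x (Lagrange.basis s id (l : ℝ)) := by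
    intro l
    rw [hev]
    simp [hL]
  refine ⟨s, p, ⟨fun l => ?_, fun l m hlm => ?_, hsum⟩, ?_⟩
  · conv_lhs => rw [hpl l, ← polyEval_mul, hev]
    simp [hL]
  · rw [hpl l, hpl m, ← polyEval_mul, hev]
    refine Finset.sum_eq_zero fun k _ => ?_
    rw [eval_mul, hL, hL]
    by_cases hk : k = l
    · simp [hk, hlm]
    · simp [hk]
  · rw [← polyEval_X x, hev]
    simp

end Resolution

/-! ### Spectral theorem, square roots and inverses -/

section Frame

variable {J : Type*} [EuclideanJordanAlgebra J]

/-- A finite set of non-zero pairwise orthogonal idempotents with sum `1` that diagonalizes `x`. -/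
structure Diagonalizes (x : J) (s : Finset J) : Prop where
  idem : ∀ c ∈ s, IsIdempotent c
  orth : ∀ c ∈ s, ∀ d ∈ s, c ≠ d → c * d = 0
  sum_eq_one : ∑ c ∈ s, c = 1
  diag : ∀ c ∈ s, ∃ ξ : ℝ, x * c = ξ • c

lemma Diagonalizes.isResolution {x : J} {s : Finset J} (h : Diagonalizes x s) :
    IsResolution fun c : s => (c : J) where
  idem c := (h.idem c c.2).2
  orth c d hcd := h.orth c c.2 d d.2 fun e => hcd (Subtype.ext e)
  sum_eq_one := (Finset.sum_coe_sort s fun c => c).trans h.sum_eq_one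

/-- A diagonalizing set can be refined at a non-primitive element. -/
lemma Diagonalizes.exists_card_lt {x : J} {s : Finset J} (h : Diagonalizes x s) {c : J}
    (hc : c ∈ s) (hprim : ¬ IsPrimitive ⊤ c) : ∃ t, Diagonalizes x t ∧ s.card < t.card := by
  classical
  have hex : ∃ a b : J, IsIdempotent a ∧ IsIdempotent b ∧ a + b = c := by
    by_contra hcon
    refine hprim ⟨Submodule.mem_top, h.idem c hc, ?_⟩
    rintro ⟨a, -, b, -, ha, hb, hab⟩
    exact hcon ⟨a, b, ha, hb, hab⟩
  obtain ⟨a, b, ha, hb, hab⟩ := hex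
  have h0 : a * b = 0 := mul_eq_zero_of_add_idempotent ha.2 hb.2 (hab ▸ (h.idem c hc).2)
  have haorth : ∀ d ∈ s, d ≠ c → a * d = 0 := fun d hd hdc =>
    mul_eq_zero_of_add ha.2 hb.2 (h.idem d hd).2 (hab ▸ h.orth c hc d hd hdc.symm)
  have hborth : ∀ d ∈ s, d ≠ c → b * d = 0 := fun d hd hdc =>
    mul_eq_zero_of_add hb.2 ha.2 (h.idem d hd).2
      (add_comm a b ▸ hab ▸ h.orth c hc d hd hdc.symm)
  have hne : a ≠ b := by
    rintro rfl
    exact ha.1 (ha.2.symm.trans h0)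
  have hanot : a ∉ s.erase c := fun hm => ha.1 (ha.2.symm.trans
    (haorth a (Finset.mem_of_mem_erase hm) (Finset.ne_of_mem_erase hm)))
  have hbnot : b ∉ s.erase c := fun hm => hb.1 (hb.2.symm.trans
    (hborth b (Finset.mem_of_mem_erase hm) (Finset.ne_of_mem_erase hm)))
  have hanot' : a ∉ insert b (s.erase c) := by
    rw [Finset.mem_insert, not_or]; exact ⟨hne, hanot⟩
  have hca : c * a = a := by rw [← hab, add_mul, ha.2, mul_comm, h0, add_zero]
  have hcb : c * b = b := by rw [← hab, add_mul, hb.2, h0, zero_add]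
  obtain ⟨ξ, hξ⟩ := h.diag c hc
  have hx : x = ξ • c + ∑ d ∈ s.erase c, x * d := by
    rw [← hξ, Finset.add_sum_erase s _ hc, ← Finset.mul_sum, h.sum_eq_one, mul_one]
  have hdiag : ∀ u : J, c * u = u → (∀ d ∈ s, d ≠ c → u * d = 0) → x * u = ξ • u := by
    intro u hcu hud
    rw [hx, add_mul, smul_mul_assoc, hcu, Finset.sum_mul, Finset.sum_eq_zero, add_zero]
    intro d hd
    obtain ⟨η, hη⟩ := h.diag d (Finset.mem_of_mem_erase hd)
    rw [hη, smul_mul_assoc, mul_comm, hud d (Finset.mem_of_mem_erase hd) (Finset.ne_of_mem_erase hd),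
      smul_zero]
  refine ⟨insert a (insert b (s.erase c)), ⟨?_, ?_, ?_, ?_⟩, ?_⟩
  · intro d hd
    rcases Finset.mem_insert.1 hd with rfl | hd
    · exact ha
    rcases Finset.mem_insert.1 hd with rfl | hd
    · exact hb
    exact h.idem d (Finset.mem_of_mem_erase hd)
  · have key : ∀ d ∈ insert a (insert b (s.erase c)), d = a ∨ d = b ∨ d ∈ s ∧ d ≠ c := by
      intro d hd
      rw [Finset.mem_insert, Finset.mem_insert, Finset.mem_erase] at hd
      tauto
    intro d hd e he hde
    rcases key d hd with h1 | h1 | ⟨h1, h1'⟩ <;> rcases key e he with h2 | h2 | ⟨h2, h2'⟩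
    · exact absurd (h1.trans h2.symm) hde
    · rw [h1, h2, h0]
    · rw [h1, haorth e h2 h2']
    · rw [h1, h2, mul_comm, h0]
    · exact absurd (h1.trans h2.symm) hde
    · rw [h1, hborth e h2 h2']
    · rw [h2, mul_comm, haorth d h1 h1']
    · rw [h2, mul_comm, hborth d h1 h1']
    · exact h.orth d h1 e h2 hde
  · rw [Finset.sum_insert hanot', Finset.sum_insert hbnot, ← add_assoc, hab,
      Finset.add_sum_erase s (fun d => d) hc, h.sum_eq_one]
  · intro d hd
    rcases Finset.mem_insert.1 hd with rfl | hd
    · exact ⟨ξ, hdiag _ hca haorth⟩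
    rcases Finset.mem_insert.1 hd with rfl | hd
    · exact ⟨ξ, hdiag _ hcb hborth⟩
    exact h.diag d (Finset.mem_of_mem_erase hd)
  · rw [Finset.card_insert_of_notMem hanot', Finset.card_insert_of_notMem hbnot,
      Finset.card_erase_of_mem hc]
    have := Finset.card_pos.2 ⟨c, hc⟩
    omega

variable [FiniteDimensional ℝ J]

lemma Diagonalizes.card_le {x : J} {s : Finset J} (h : Diagonalizes x s) :
    s.card ≤ Module.finrank ℝ J := by
  have hli : LinearIndependent ℝ fun c : s => (c : J) :=
    linearIndependent_of_ne_zero_of_inner_eq_zero (fun c => (h.idem c c.2).1) fun c d hcd =>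
      inner_eq_zero_of_mul_eq_zero (h.idem d d.2).2 (h.isResolution.orth c d hcd)
  simpa using hli.fintype_card_le_finrank

lemma exists_diagonalizes (x : J) : ∃ s, Diagonalizes x s := by
  classical
  obtain ⟨t, p, hp, hx⟩ := exists_resolution x
  refine ⟨(Finset.univ.image p).erase 0, ?_, ?_, ?_, ?_⟩
  · intro c hc
    obtain ⟨i, -, rfl⟩ := Finset.mem_image.1 (Finset.mem_of_mem_erase hc)
    exact ⟨Finset.ne_of_mem_erase hc, hp.idem i⟩
  · intro c hc d hd hcd
    obtain ⟨i, -, rfl⟩ := Finset.mem_image.1 (Finset.mem_of_mem_erase hc)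
    obtain ⟨j, -, rfl⟩ := Finset.mem_image.1 (Finset.mem_of_mem_erase hd)
    exact hp.orth i j fun e => hcd (e ▸ rfl)
  · rw [Finset.sum_erase _ (f := fun c => c) rfl, Finset.sum_image_of_pairwise_eq_zero, hp.sum_eq_one]
    -- If two distinct indices share a value, it is an idempotent orthogonal to itself, hence zero,
    -- and collapsing the image loses nothing.
    intro i _ j _ hij he
    rw [← hp.idem i]
    conv_lhs => rw [he, ← he]
    nth_rewrite 2 [he]
    exact hp.orth i j hij
  · intro c hc
    obtain ⟨i, -, rfl⟩ := Finset.mem_image.1 (Finset.mem_of_mem_erase hc)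
    exact ⟨i, by rw [hx, hp.sum_smul_mul]⟩

/-- The spectral theorem. -/
lemma exists_jordanFrame (x : J) : ∃ (r : ℕ) (c : Fin r → J) (ξ : Fin r → ℝ),
    IsJordanFrame ⊤ c ∧ IsResolution c ∧ x = ∑ i, ξ i • c i := by
  classical
  -- The dimension bounds the cardinality, so a largest diagonalizing set exists; by
  -- `Diagonalizes.exists_card_lt` its members are primitive.
  have hex : ∃ s : Finset J, Diagonalizes x s ∧ ∀ t, Diagonalizes x t → t.card ≤ s.card := by
    obtain ⟨s₀, hs₀⟩ := exists_diagonalizes x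
    let P : ℕ → Prop := fun k => ∃ s : Finset J, Diagonalizes x s ∧ s.card = k
    obtain ⟨s, hs, hsc⟩ : P (Nat.findGreatest P (Module.finrank ℝ J)) :=
      Nat.findGreatest_spec hs₀.card_le ⟨s₀, hs₀, rfl⟩
    exact ⟨s, hs, fun t ht => hsc ▸ Nat.le_findGreatest ht.card_le ⟨t, ht, rfl⟩⟩
  obtain ⟨s, hs, hmax⟩ := hex
  choose ξ hξ using fun c : s => hs.diag c c.2
  let e := s.equivFin.symm
  have hres : IsResolution fun i => (e i : J) :=
    ⟨fun i => hs.isResolution.idem _, fun i j hij => hs.isResolution.orth _ _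
      fun h => hij (e.injective h), (e.sum_comp fun c : s => (c : J)).trans
      hs.isResolution.sum_eq_one⟩
  refine ⟨s.card, fun i => e i, fun i => ξ (e i), ⟨?_, hres.orth, ?_⟩, hres, ?_⟩
  · intro i
    by_contra hi
    obtain ⟨t, ht, hlt⟩ := hs.exists_card_lt (e i).2 hi
    exact absurd (hmax t ht) hlt.not_ge
  · rintro ⟨d, hd, h0⟩
    refine hd.2.1.1 ?_
    rw [← mul_one d, ← hres.sum_eq_one, Finset.mul_sum]
    exact Finset.sum_eq_zero fun i _ => h0 i
  · simp only [← hξ, ← Finset.mul_sum, hres.sum_eq_one, mul_one]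

/-- Otherwise the complement `f = 1 - ∑ cᵢ` is a nonzero idempotent. A primitive idempotent from its
spectral decomposition lies below `f`, is orthogonal to every `cᵢ`, and contradicts maximality. -/
lemma IsJordanFrame.isResolution {r : ℕ} {c : Fin r → J} (h : IsJordanFrame ⊤ c) :
    IsResolution c := by
  refine ⟨fun i => (h.1 i).2.1.2, h.2.1, ?_⟩
  by_contra hne
  set f : J := 1 - ∑ i, c i with hf
  have hf0 : f ≠ 0 := fun h0 => hne (sub_eq_zero.1 h0).symm
  have hcc : ∀ j, (∑ i, c i) * c j = c j := by
    intro j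
    rw [Finset.sum_mul, Finset.sum_eq_single j (fun i _ hij => h.2.1 i j hij) (by simp),
      (h.1 j).2.1.2]
  have hfc : ∀ j, f * c j = 0 := fun j => by rw [hf, sub_mul, one_mul, hcc, sub_self]
  have hff : f * f = f := by
    conv_lhs => rw [hf, mul_sub, mul_one, ← hf, Finset.mul_sum]
    simp [hfc]
  obtain ⟨k, d, ξ, hd, hres, hx⟩ := exists_jordanFrame f
  have hξ : ∃ i, ξ i ≠ 0 := by
    by_contra! hcon
    exact hf0 (by simp [hx, hcon])
  obtain ⟨i, hi⟩ := hξ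
  have hfd : f * d i = ξ i • d i := by rw [hx, hres.sum_smul_mul]
  have h1 : ξ i = 1 := by
    have h2 : (f * f) * d i = (ξ i * ξ i) • d i := by
      conv_lhs => rw [hx, hres.sum_smul_mul_sum_smul, hres.sum_smul_mul]
    rw [hff, hfd] at h2
    exact (mul_left_cancel₀ hi (by
      rw [mul_one]; exact smul_left_injective ℝ (hd.1 i).2.1.1 h2)).symm
  rw [h1, one_smul] at hfd
  refine h.2.2 ⟨d i, hd.1 i, fun j => ?_⟩
  refine mul_eq_zero_of_add (hres.idem i) (sub_mul_sub_idempotent (hres.idem i) hff hfd)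
    (h.1 j).2.1.2 ?_
  rw [add_sub_cancel, hfc]

lemma exists_pos_of_mem_cone {x : J} (hx : x ∈ cone J) :
    ∃ (r : ℕ) (c : Fin r → J) (ξ : Fin r → ℝ), IsJordanFrame ⊤ c ∧ IsResolution c ∧
      (∀ i, 0 < ξ i) ∧ x = ∑ i, ξ i • c i := by
  obtain ⟨r, c, ξ, hc, hres, rfl⟩ := exists_jordanFrame x
  exact ⟨r, c, ξ, hc, hres, fun i => hres.pos_of_sum_smul_mem_cone hx (hc.1 i).2.1.1, rfl⟩

lemma eigenvalues_spec (x : J) : IsSpectrum ⊤ x (eigenvalues ⊤ x) := by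
  have h : ∃ s, IsSpectrum ⊤ x s := by
    obtain ⟨r, c, ξ, hc, -, hx⟩ := exists_jordanFrame x
    exact ⟨_, r, c, ξ, hc, hx, rfl⟩
  rw [eigenvalues, dif_pos h]
  exact h.choose_spec

/-! ### Square roots and inverses in the cone -/

lemma sqrt_spec {x : J} (hx : x ∈ cone J) : sqrt x ∈ cone J ∧ sqrt x * sqrt x = x := by
  have h : ∃ z ∈ cone J, z * z = x := by
    obtain ⟨r, c, ξ, -, hres, hξ, rfl⟩ := exists_pos_of_mem_cone hx
    refine ⟨_, hres.sum_smul_mem_cone fun i => Real.sqrt_pos.2 (hξ i), ?_⟩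
    rw [hres.sum_smul_mul_sum_smul]
    simp only [Real.mul_self_sqrt (hξ _).le]
  rw [sqrt, dif_pos h]
  exact h.choose_spec

/-- Apply the functional calculus of the common square to `Real.sqrt`; positivity of the
coefficients recovers both elements. -/
lemma eq_of_sq_eq_of_mem_cone {a b : J} (ha : a ∈ cone J) (hb : b ∈ cone J)
    (hab : a * a = b * b) : a = b := by
  obtain ⟨r, c, ξ, -, hres, hξ, rfl⟩ := exists_pos_of_mem_cone ha
  obtain ⟨k, d, η, -, hres', hη, rfl⟩ := exists_pos_of_mem_cone hb
  rw [hres.sum_smul_mul_sum_smul, hres'.sum_smul_mul_sum_smul] at hab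
  have := hres.sum_smul_congr hres' hab Real.sqrt
  simpa only [Real.sqrt_mul_self (hξ _).le, Real.sqrt_mul_self (hη _).le] using this

lemma sqrt_eq {x z : J} (hz : z ∈ cone J) (h : z * z = x) : sqrt x = z := by
  have hx : ∃ z ∈ cone J, z * z = x := ⟨z, hz, h⟩
  rw [sqrt, dif_pos hx]
  exact eq_of_sq_eq_of_mem_cone hx.choose_spec.1 hz (hx.choose_spec.2.trans h.symm)

lemma inv_mem_cone {x : J} (hx : x ∈ cone J) : inv x ∈ cone J := by
  obtain ⟨r, c, ξ, -, hres, hξ, rfl⟩ := exists_pos_of_mem_cone hx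
  rw [hres.inv_sum_smul fun i => (hξ i).ne']
  exact hres.sum_smul_mem_cone fun i => inv_pos.2 (hξ i)

lemma sqrt_inv {x : J} (hx : x ∈ cone J) : sqrt (inv x) = inv (sqrt x) := by
  obtain ⟨h1, h2⟩ := sqrt_spec hx
  refine sqrt_eq (inv_mem_cone h1) ?_
  obtain ⟨r, c, ξ, -, hres, hξ, ha⟩ := exists_pos_of_mem_cone h1
  conv_rhs => rw [← h2]
  rw [ha, hres.inv_sum_smul fun i => (hξ i).ne', hres.sum_smul_mul_sum_smul,
    hres.sum_smul_mul_sum_smul, hres.inv_sum_smul fun i => (mul_pos (hξ i) (hξ i)).ne']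
  simp only [mul_inv]

lemma inv_inv_of_mem_cone {x : J} (hx : x ∈ cone J) : inv (inv x) = x := by
  obtain ⟨r, c, ξ, -, hres, hξ, rfl⟩ := exists_pos_of_mem_cone hx
  rw [hres.inv_sum_smul fun i => (hξ i).ne',
    hres.inv_sum_smul fun i => (inv_pos.2 (hξ i)).ne']
  simp only [inv_inv]

lemma quadRep_inv {x : J} (hx : x ∈ cone J) : quadRep x (inv x) = x := by
  obtain ⟨r, c, ξ, -, hres, hξ, rfl⟩ := exists_pos_of_mem_cone hx
  rw [hres.inv_sum_smul fun i => (hξ i).ne', hres.quadRep_sum_smul]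
  refine Finset.sum_congr rfl fun i _ => ?_
  rw [pow_two, mul_assoc, mul_inv_cancel₀ (hξ i).ne', mul_one]

lemma star_inv_self {x : J} (hx : x ∈ cone J) : star x (inv x) = 1 := by
  obtain ⟨h1, h2⟩ := sqrt_spec hx
  obtain ⟨r, c, ξ, -, hres, hξ, ha⟩ := exists_pos_of_mem_cone h1
  rw [star]
  conv_lhs => rw [← h2]
  rw [sqrt_eq h1 rfl, ha, hres.sum_smul_mul_sum_smul,
    hres.inv_sum_smul fun i => (mul_pos (hξ i) (hξ i)).ne', hres.quadRep_sum_smul,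
    ← hres.sum_eq_one]
  refine Finset.sum_congr rfl fun i _ => ?_
  have := (hξ i).ne'
  rw [pow_two, mul_inv_cancel₀ (by positivity), one_smul]

lemma star_one_right {x : J} (hx : x ∈ cone J) : star x 1 = x := by
  rw [star, quadRep_one_right, (sqrt_spec hx).2]

lemma star_one_left (x : J) : star 1 x = x := by
  rw [star, sqrt_eq one_mem_cone (mul_one 1), quadRep_one_left]

end Frame

/-! ### Exponentials, the fundamental formula and the automorphism in `K` -/

section Exponential

open NormedSpace

open scoped Pointwise

variable {J : Type*} [EuclideanJordanAlgebra J]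

lemma IsSpectrum.smul {k : (J →L[ℝ] J)ˣ} (hk : ∀ u v : J, k • (u * v) = (k • u) * (k • v))
    {x : J} {s : Multiset ℝ} (h : IsSpectrum ⊤ x s) : IsSpectrum ⊤ (k • x) s := by
  have hidem : ∀ {g : (J →L[ℝ] J)ˣ}, (∀ u v : J, g • (u * v) = (g • u) * (g • v)) → ∀ {c : J},
      IsIdempotent c → IsIdempotent (g • c) := fun {g} hg {c} hc =>
    ⟨fun h0 => hc.1 ((smul_eq_zero_iff_eq g).1 h0), by rw [← hg, hc.2]⟩
  have hki : ∀ u v : J, k⁻¹ • (u * v) = (k⁻¹ • u) * (k⁻¹ • v) := fun u v => by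
    rw [inv_smul_eq_iff, hk, smul_inv_smul, smul_inv_smul]
  have hprim : ∀ {g : (J →L[ℝ] J)ˣ}, (∀ u v : J, g • (u * v) = (g • u) * (g • v)) →
      (∀ u v : J, g⁻¹ • (u * v) = (g⁻¹ • u) * (g⁻¹ • v)) → ∀ {c : J},
      IsPrimitive ⊤ c → IsPrimitive ⊤ (g • c) := by
    rintro g hg hgi c ⟨-, hc, hcp⟩
    refine ⟨Submodule.mem_top, hidem hg hc, ?_⟩
    rintro ⟨a, -, b, -, ha, hb, hab⟩
    exact hcp ⟨g⁻¹ • a, Submodule.mem_top, g⁻¹ • b, Submodule.mem_top, hidem hgi ha,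
      hidem hgi hb, by rw [← smul_add, hab, inv_smul_smul]⟩
  obtain ⟨r, c, ξ, ⟨h1, h2, h3⟩, rfl, rfl⟩ := h
  refine ⟨r, fun i => k • c i, ξ, ⟨fun i => hprim hk hki (h1 i), fun i j hij => ?_, ?_⟩, ?_, rfl⟩
  · rw [← hk, h2 i j hij, smul_zero]
  · rintro ⟨d, hd, h0⟩
    refine h3 ⟨k⁻¹ • d, hprim hki (by simpa using hk) hd, fun i => ?_⟩
    rw [← smul_eq_zero_iff_eq k, hk, smul_inv_smul, h0]
  · rw [Finset.smul_sum]
    exact Finset.sum_congr rfl fun i _ => map_smul (k : J →L[ℝ] J) (ξ i) (c i)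

lemma eigenvalues_smul {k : (J →L[ℝ] J)ˣ} (hk : ∀ u v : J, k • (u * v) = (k • u) * (k • v))
    (x : J) : eigenvalues ⊤ (k • x) = eigenvalues ⊤ x := by
  have hki : ∀ u v : J, k⁻¹ • (u * v) = (k⁻¹ • u) * (k⁻¹ • v) := fun u v => by
    rw [inv_smul_eq_iff, hk, smul_inv_smul, smul_inv_smul]
  -- Equality of the predicates makes the choices in `eigenvalues` coincide, so uniqueness of the
  -- spectrum is never needed.
  have : IsSpectrum ⊤ (k • x) = IsSpectrum ⊤ x := funext fun s => propext
    ⟨fun h => by simpa using h.smul hki, fun h => h.smul hk⟩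
  unfold eigenvalues
  rw [this]

variable [FiniteDimensional ℝ J]

lemma exp_add_of_commute_end {A B : J →L[ℝ] J} (h : Commute A B) :
    exp (A + B) = exp A * exp B := by
  have : CompleteSpace J := FiniteDimensional.complete ℝ J
  let _ : NormedAlgebra ℚ (J →L[ℝ] J) := NormedAlgebra.restrictScalars ℚ ℝ _
  exact exp_add_of_commute h

lemma continuous_exp_end : Continuous (exp : (J →L[ℝ] J) → J →L[ℝ] J) := by
  have : CompleteSpace J := FiniteDimensional.complete ℝ J
  let _ : NormedAlgebra ℚ (J →L[ℝ] J) := NormedAlgebra.restrictScalars ℚ ℝ _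
  exact exp_continuous

/-- The quadratic representation as a continuous linear map. -/
noncomputable def quadL (x : J) : J →L[ℝ] J := (2 : ℝ) • (mulL J x * mulL J x) - mulL J (x * x)

lemma quadL_apply (x y : J) : quadL x y = quadRep x y := rfl

lemma quadL_one : quadL (1 : J) = 1 := by
  ext y; rw [quadL_apply, quadRep_one_left]; rfl

lemma exp_neg_mul_exp (A : J →L[ℝ] J) : exp (-A) * exp A = 1 := by
  rw [← exp_add_of_commute_end (Commute.refl A).neg_left, neg_add_cancel, exp_zero]

lemma exp_mul_exp_neg (A : J →L[ℝ] J) : exp A * exp (-A) = 1 := by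
  simpa using exp_neg_mul_exp (-A)

lemma exp_end_injective (A : J →L[ℝ] J) : Function.Injective (exp A : J →L[ℝ] J) := by
  intro u v huv
  have h : ∀ w, exp (-A) (exp A w) = w := fun w => DFunLike.congr_fun (exp_neg_mul_exp A) w
  rw [← h u, huv, h]

lemma exp_apply_of_eigenvector {A : J →L[ℝ] J} {μ : ℝ} {v : J} (h : A v = μ • v) :
    exp A v = Real.exp μ • v := by
  have : CompleteSpace J := FiniteDimensional.complete ℝ J
  have hpow : ∀ n : ℕ, (A ^ n) v = μ ^ n • v := by
    intro n
    induction n with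
    | zero => simp
    | succ n ih => rw [pow_succ', mul_apply_eq_comp, ih, map_smul, h, smul_smul, pow_succ]
  have h1 := (ContinuousLinearMap.apply ℝ J v).hasSum (exp_series_hasSum_exp' (𝕂 := ℝ) A)
  have h2 := (exp_series_hasSum_exp' (𝕂 := ℝ) μ).smul_const v
  rw [← Real.exp_eq_exp_ℝ] at h2
  have e : ∀ n : ℕ, ContinuousLinearMap.apply ℝ J v ((n.factorial : ℝ)⁻¹ • A ^ n) =
      ((n.factorial : ℝ)⁻¹ • μ ^ n) • v := fun n => by
    change ((n.factorial : ℝ)⁻¹ • A ^ n) v = _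
    rw [smul_apply, hpow, smul_assoc]
  exact h1.unique (by simp only [e]; exact h2)

lemma IsResolution.exp_mulL_one {ι : Type*} [Fintype ι] {c : ι → J} (h : IsResolution c)
    (ξ : ι → ℝ) : exp (mulL J (∑ i, ξ i • c i)) 1 = ∑ i, Real.exp (ξ i) • c i := by
  rw [← h.sum_eq_one, map_sum]
  exact Finset.sum_congr rfl fun i _ => exp_apply_of_eigenvector (h.sum_smul_mul ξ i)

lemma IsResolution.exp_mulL_log {ι : Type*} [Fintype ι] {c : ι → J} (h : IsResolution c)
    {ξ : ι → ℝ} (hξ : ∀ i, 0 < ξ i) :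
    exp (mulL J (∑ i, Real.log (ξ i) • c i)) 1 = ∑ i, ξ i • c i := by
  rw [h.exp_mulL_one]
  simp only [Real.exp_log (hξ _)]

lemma exists_log {x : J} (hx : x ∈ cone J) : ∃ z : J, exp (mulL J z) 1 = x := by
  obtain ⟨r, c, ξ, -, hres, hξ, rfl⟩ := exists_pos_of_mem_cone hx
  exact ⟨_, hres.exp_mulL_log hξ⟩

/-- Along `y(t) = exp (tA) y`, with `A = L(x)`, `quadRep_polar_mul` says that `Q(t) = P(y(t))`
solves `Q' = AQ + QA`. Therefore `exp (-tA) Q(t) exp (-tA)` is constant; compare `t = 1` with `t =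
0`. -/
lemma quadL_exp_apply (x y : J) :
    quadL (exp (mulL J x) y) = exp (mulL J x) * quadL y * exp (mulL J x) := by
  have : CompleteSpace J := FiniteDimensional.complete ℝ J
  set A := mulL J x with hA
  have hy : ∀ t : ℝ, HasDerivAt (fun t : ℝ => exp (t • A) y) (x * exp (t • A) y) t := fun t =>
    ((hasDerivAt_exp_smul_const' A t).clm_apply (hasDerivAt_const t y)).congr_deriv (by
      simp [hA, mulL_apply])
  have hP : ∀ t : ℝ, HasDerivAt (fun t : ℝ => quadL (exp (t • A) y))
      (A * quadL (exp (t • A) y) + quadL (exp (t • A) y) * A) t := by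
    intro t
    have h1 : HasDerivAt (fun t : ℝ => mulL J (exp (t • A) y)) (mulL J (x * exp (t • A) y)) t :=
      (mulL J).hasFDerivAt.comp_hasDerivAt t (hy t)
    have h2 : HasDerivAt (fun t : ℝ => exp (t • A) y * exp (t • A) y)
        ((2 : ℝ) • (x * exp (t • A) y * exp (t • A) y)) t :=
      (h1.clm_apply (hy t)).congr_deriv (by
        simp only [mulL_apply]; rw [two_smul, mul_comm (exp (t • A) y)])
    have h3 := ((h1.mul h1).const_smul (2 : ℝ)).sub ((mulL J).hasFDerivAt.comp_hasDerivAt t h2)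
    refine h3.congr_deriv ?_
    ext w
    have := quadRep_polar_mul x (exp (t • A) y) w
    simp only [quadL, add_apply, sub_apply, smul_apply, mul_apply_eq_comp, mulL_apply, map_smul,
      hA] at this ⊢
    rw [← this]
    module
  set F : ℝ → J →L[ℝ] J := fun t => exp (t • -A) * quadL (exp (t • A) y) * exp (t • -A) with hF
  have hF' : ∀ t, HasDerivAt F 0 t := fun t =>
    (((hasDerivAt_exp_smul_const (-A) t).mul (hP t)).mul
      (hasDerivAt_exp_smul_const' (-A) t)).congr_deriv (by
        simp only [Pi.mul_apply]; noncomm_ring)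
  have hconst := is_const_of_deriv_eq_zero (fun t => (hF' t).differentiableAt)
    (fun t => (hF' t).deriv) 1 0
  simp only [hF, one_smul, zero_smul, exp_zero, one_mul, mul_one,
    one_apply_eq_self] at hconst
  rw [← hconst]
  simp only [mul_assoc, exp_neg_mul_exp, mul_one]
  rw [← mul_assoc, exp_mul_exp_neg, one_mul]

lemma quadL_exp_one (x : J) : quadL (exp (mulL J x) 1) = exp (mulL J ((2 : ℝ) • x)) := by
  rw [quadL_exp_apply, quadL_one, mul_one, map_smul, two_smul,
    exp_add_of_commute_end (Commute.refl _)]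

/-- The exponential of `A` as an invertible operator. -/
noncomputable def expUnit (A : J →L[ℝ] J) : (J →L[ℝ] J)ˣ :=
  ⟨exp A, exp (-A), exp_mul_exp_neg A, exp_neg_mul_exp A⟩

lemma continuous_expUnit : Continuous (expUnit : (J →L[ℝ] J) → (J →L[ℝ] J)ˣ) := by
  exact Units.continuous_iff.2 ⟨continuous_exp_end, continuous_exp_end.comp continuous_neg⟩

/-- The fundamental formula, for `x` in the cone. -/
lemma quadL_quadRep {x : J} (hx : x ∈ cone J) (y : J) :
    quadL (quadRep x y) = quadL x * quadL y * quadL x := by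
  obtain ⟨z, rfl⟩ := exists_log hx
  rw [← quadL_apply, quadL_exp_one, quadL_exp_apply]

lemma quadL_mul_self {x : J} (hx : x ∈ cone J) : quadL (x * x) = quadL x * quadL x := by
  rw [← quadRep_one_right, quadL_quadRep hx, quadL_one, mul_one]

/-- A zero coefficient of `v` would put the corresponding idempotent in the kernel of `P(v²)`. -/
lemma mul_self_mem_cone_of_injective {v : J} (h : Function.Injective (quadL (v * v))) :
    v * v ∈ cone J := by
  obtain ⟨r, c, ξ, hc, hres, rfl⟩ := exists_jordanFrame v
  rw [hres.sum_smul_mul_sum_smul] at h ⊢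
  refine hres.sum_smul_mem_cone fun i => mul_self_pos.2 fun h0 => (hc.1 i).2.1.1 (h ?_)
  rw [map_zero, quadL_apply, hres.quadRep_sum_smul_apply, h0]
  simp

lemma quadL_injective {x : J} (hx : x ∈ cone J) : Function.Injective (quadL x) := by
  obtain ⟨z, rfl⟩ := exists_log hx
  rw [quadL_exp_one]
  exact exp_end_injective (mulL J ((2 : ℝ) • z))

/-- The times at which the curve lies in the cone form an open set. It is also closed: squares are
closed, and on this curve `P` stays injective, so being a square already means being in the cone.
Connectedness of `ℝ` finishes. -/
lemma exp_mulL_apply_mem_cone (x : J) {y : J} (hy : y ∈ cone J) :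
    exp (mulL J x) y ∈ cone J := by
  set g : ℝ → J := fun t => exp (mulL J (t • x)) y with hg
  have hgc : Continuous g := by
    have h1 : Continuous (exp : (J →L[ℝ] J) → J →L[ℝ] J) := continuous_exp_end
    fun_prop
  have hclosed : IsClosed (g ⁻¹' cone J) := by
    have : g ⁻¹' cone J = g ⁻¹' squares J := by
      refine Set.Subset.antisymm (Set.preimage_mono interior_subset) ?_
      rintro t ⟨v, hv⟩
      have hv : v * v = g t := hv
      rw [Set.mem_preimage, ← hv]
      refine mul_self_mem_cone_of_injective ?_
      rw [hv, hg, quadL_exp_apply]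
      have hE := exp_end_injective (mulL J (t • x))
      exact (hE.comp (quadL_injective hy)).comp hE
    rw [this]
    exact isClosed_squares.preimage hgc
  have huniv : g ⁻¹' cone J = Set.univ :=
    IsClopen.eq_univ ⟨hclosed, isOpen_interior.preimage hgc⟩ ⟨0, by simpa [hg] using hy⟩
  have : (1 : ℝ) ∈ g ⁻¹' cone J := huniv ▸ Set.mem_univ _
  simpa [hg] using this

lemma expUnit_mulL_mem_coneAut (x : J) : expUnit (mulL J x) ∈ coneAut J := by
  have key : ∀ z : J, expUnit (mulL J z) • cone J ⊆ cone J := by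
    rintro z _ ⟨y, hy, rfl⟩
    exact exp_mulL_apply_mem_cone z hy
  have hinv : (expUnit (mulL J x))⁻¹ = expUnit (mulL J (-x)) := by
    ext1
    simp [expUnit]
  refine MulAction.mem_stabilizer_iff.2 (Set.Subset.antisymm (key x) ?_)
  rw [Set.subset_smul_set_iff, hinv]
  exact key (-x)

lemma expUnit_mulL_mem_groupG (x : J) : expUnit (mulL J x) ∈ groupG J := by
  refine ⟨⟨expUnit (mulL J x), expUnit_mulL_mem_coneAut x⟩, ?_, rfl⟩
  set g : ℝ → coneAut J := fun t =>
    ⟨expUnit (mulL J (t • x)), expUnit_mulL_mem_coneAut (t • x)⟩ with hg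
  have hgc : Continuous g := by
    refine Continuous.subtype_mk (continuous_expUnit.comp ?_) _
    fun_prop
  have h0 : g 0 = 1 := by
    refine Subtype.ext (Units.ext ?_)
    simp [hg, expUnit]
  have h1 : g 1 = ⟨expUnit (mulL J x), expUnit_mulL_mem_coneAut x⟩ := by simp [hg]
  rw [← h1]
  exact (isPreconnected_range hgc).subset_connectedComponent ⟨0, h0⟩ ⟨1, rfl⟩

lemma exists_mem_groupG_eq_quadL {x : J} (hx : x ∈ cone J) :
    ∃ g ∈ groupG J, (g : J →L[ℝ] J) = quadL x := by
  obtain ⟨z, rfl⟩ := exists_log hx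
  exact ⟨_, expUnit_mulL_mem_groupG ((2 : ℝ) • z), (quadL_exp_one z).symm⟩

lemma quadRep_mem_cone {x y : J} (hx : x ∈ cone J) (hy : y ∈ cone J) : quadRep x y ∈ cone J := by
  obtain ⟨g, hg, h⟩ := exists_mem_groupG_eq_quadL hx
  rw [← quadL_apply, ← h]
  exact smul_mem_cone hg hy

lemma star_mem_cone {x y : J} (hx : x ∈ cone J) (hy : y ∈ cone J) : star x y ∈ cone J :=
  quadRep_mem_cone (sqrt_spec hx).1 hy

lemma quadL_inv_mul {x : J} (hx : x ∈ cone J) : quadL (inv x) * quadL x = 1 := by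
  obtain ⟨r, c, ξ, -, hres, hξ, rfl⟩ := exists_pos_of_mem_cone hx
  rw [hres.inv_sum_smul fun i => (hξ i).ne', ← hres.exp_mulL_log hξ,
    ← hres.exp_mulL_log fun i => inv_pos.2 (hξ i), quadL_exp_one, quadL_exp_one]
  simp only [Real.log_inv, neg_smul, Finset.sum_neg_distrib, smul_neg, map_neg]
  exact exp_neg_mul_exp _

/-- The injective operator `P(P(x)y) = P(x)P(y)P(x)` sends both sides to `P(x)y`. -/
lemma inv_quadRep {x y : J} (hx : x ∈ cone J) (hy : y ∈ cone J) :
    inv (quadRep x y) = quadRep (inv x) (inv y) := by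
  have hxy := quadRep_mem_cone hx hy
  refine quadL_injective hxy ?_
  rw [quadL_apply, quadRep_inv hxy, quadL_quadRep hx, ← quadL_apply, ← quadL_apply,
    ← mul_apply_eq_comp]
  have h : quadL x * quadL (inv x) = 1 := by
    have := quadL_inv_mul (inv_mem_cone hx)
    rwa [inv_inv_of_mem_cone hx] at this
  rw [mul_assoc, h, mul_one, mul_apply_eq_comp, quadL_apply y, quadRep_inv hy]

lemma inv_star {x y : J} (hx : x ∈ cone J) (hy : y ∈ cone J) :
    inv (star x y) = star (inv x) (inv y) := by
  rw [star, star, inv_quadRep (sqrt_spec hx).1 hy, sqrt_inv hx]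

/-! ### The element of `K` relating `x ⋆ y` and `y ⋆ x` -/

lemma exists_groupK_smul_star {x y : J} (hx : x ∈ cone J) (hy : y ∈ cone J) :
    ∃ k ∈ groupK J, k • star y x = star x y ∧ ∀ u v : J, k • (u * v) = (k • u) * (k • v) := by
  obtain ⟨ha, hax⟩ := sqrt_spec hx
  obtain ⟨hb, hby⟩ := sqrt_spec hy
  obtain ⟨hz, hzw⟩ := sqrt_spec (star_mem_cone hx hy)
  obtain ⟨A, hAG, hA⟩ := exists_mem_groupG_eq_quadL ha
  obtain ⟨B, hBG, hB⟩ := exists_mem_groupG_eq_quadL hb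
  obtain ⟨C, hCG, hC⟩ := exists_mem_groupG_eq_quadL hz
  have smulA : ∀ u, A • u = quadRep (sqrt x) u := fun u => by
    rw [← quadL_apply, ← hA]; rfl
  have smulB : ∀ u, B • u = quadRep (sqrt y) u := fun u => by
    rw [← quadL_apply, ← hB]; rfl
  have smulC : ∀ u, C • u = quadRep (sqrt (star x y)) u := fun u => by
    rw [← quadL_apply, ← hC]; rfl
  have hA1 : A • (1 : J) = x := by rw [smulA, quadRep_one_right, hax]
  have hB1 : B • (1 : J) = y := by rw [smulB, quadRep_one_right, hby]
  have hC1 : C • (1 : J) = star x y := by rw [smulC, quadRep_one_right, hzw]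
  -- Both sides are `P(x ⋆ y)`, by the fundamental formula and `P(a²) = P(a)²`.
  have hAB : A * B * B * A = C * C := by
    ext1
    simp only [Units.val_mul, hA, hB, hC]
    rw [← quadL_mul_self hz, hzw, star, quadL_quadRep ha, ← hby, quadL_mul_self hb, hby]
    simp only [mul_assoc]
  have hk1 : (C⁻¹ * A * B) • (1 : J) = 1 := by
    rw [mul_smul, mul_smul, hB1, smulA, inv_smul_eq_iff, hC1, star]
  -- By `hAB` this operator is the inverse of `C⁻¹AB`, which fixes `1`.
  have hk1' : (B * A * C⁻¹) • (1 : J) = 1 := by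
    have h : B * A * C⁻¹ = (C⁻¹ * A * B)⁻¹ := by
      rw [eq_inv_iff_mul_eq_one]
      have h1 : B * A * C⁻¹ * (C⁻¹ * A * B) = B * A * (C * C)⁻¹ * (A * B) := by group
      rw [h1, ← hAB]
      group
    rw [h, inv_smul_eq_iff, hk1]
  have hsq : ∀ u : J, (C⁻¹ * A * B) • (u * u) =
      ((C⁻¹ * A * B) • u) * ((C⁻¹ * A * B) • u) := by
    intro u
    set k := C⁻¹ * A * B with hk
    have hCk : C • k • u = A • B • u := by rw [hk, mul_smul, mul_smul, smul_inv_smul]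
    -- Two expansions of `P(Cku) = P(ABu)`. Evaluating at `C⁻¹1` yields `C(ku)² = AB(u²)`, since
    -- `BAC⁻¹` fixes `1`.
    have hq : (C : J →L[ℝ] J) * quadL (k • u) * C = A * (B * quadL u * B) * A := by
      rw [hA, hB, hC, ← quadL_quadRep hz, ← smulC, hCk, smulA, quadL_quadRep ha, smulB,
        quadL_quadRep hb]
    have h1 := DFunLike.congr_fun hq (C⁻¹ • (1 : J))
    have h2 : C • quadL (k • u) (C • C⁻¹ • (1 : J)) =
        A • B • quadL u ((B * A * C⁻¹) • (1 : J)) := by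
      rw [mul_smul, mul_smul]
      exact h1
    rw [smul_inv_smul, hk1', quadL_apply, quadL_apply, quadRep_one_right, quadRep_one_right] at h2
    rw [← inv_smul_eq_iff.2 h2.symm, hk, mul_smul, mul_smul]
  refine ⟨C⁻¹ * A * B, ⟨(groupG J).mul_mem ((groupG J).mul_mem ((groupG J).inv_mem hCG) hAG) hBG, hk1⟩, ?_, ?_⟩
  · rw [star, ← smulB]
    nth_rewrite 1 [← hA1]
    rw [← mul_smul, ← mul_smul]
    have h1 : C⁻¹ * A * B * B * A = C := by
      have : C⁻¹ * A * B * B * A = C⁻¹ * (A * B * B * A) := by group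
      rw [this, hAB]
      group
    rw [h1, hC1]
  · intro u v
    have h := hsq (u + v)
    have hu := hsq u
    have hv := hsq v
    set k := C⁻¹ * A * B
    have h2 : ∀ a : ℝ, ∀ w : J, k • (a • w) = a • (k • w) := fun a w =>
      map_smul (k : J →L[ℝ] J) a w
    have e : (u + v) * (u + v) = u * u + v * v + (2 : ℝ) • (u * v) := by
      simp only [add_mul, mul_add, mul_comm v u]; module
    rw [e, smul_add, smul_add, smul_add, h2, hu, hv] at h
    have e' : (k • u + k • v) * (k • u + k • v) =
        (k • u) * (k • u) + (k • v) * (k • v) + (2 : ℝ) • ((k • u) * (k • v)) := by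
      simp only [add_mul, mul_add, mul_comm (k • v) (k • u)]; module
    rw [e'] at h
    exact smul_right_injective J (two_ne_zero (α := ℝ)) (add_left_cancel h)

lemma zonal_smul {r : ℕ} (c : Fin r → J) (l : Fin r → ℕ) {k : (J →L[ℝ] J)ˣ} (hk : k ∈ groupK J)
    (x : J) : zonal c l (k • x) = zonal c l x := by
  let _ : MeasurableSpace (groupK J) := borel (groupK J)
  have : BorelSpace (groupK J) := ⟨rfl⟩
  have : (haarK J).IsHaarMeasure := by unfold haarK; infer_instance
  have : MeasureTheory.IsProbabilityMeasure (haarK J) :=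
    ⟨MeasureTheory.Measure.haarMeasure_self (K₀ := ⊤)⟩
  -- A right translate of Haar measure is again a Haar probability measure, so uniqueness on the
  -- compact group gives right invariance.
  have : (haarK J).IsMulRightInvariant :=
    ⟨fun g => by
      have : MeasureTheory.IsProbabilityMeasure ((haarK J).map (· * g)) :=
        MeasureTheory.Measure.isProbabilityMeasure_map (by fun_prop)
      exact MeasureTheory.Measure.isHaarMeasure_eq_of_isProbabilityMeasure _ _⟩
  have h : spherical c l (k • x) = spherical c l x := by
    simp only [spherical]
    have := MeasureTheory.integral_mul_right_eq_self (μ := haarK J)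
      (fun g : groupK J => delta c l ((g : (J →L[ℝ] J)ˣ) • x)) ⟨k, hk⟩
    simpa [mul_smul] using this
  rw [zonal, zonal, h]

end Exponential

/-! ### Associative functionals, trace and determinant -/

section Trace

variable {J : Type*} [EuclideanJordanAlgebra J]

/-- The functional `x ↦ Tr L(x)`. -/
noncomputable def traceMul : J →ₗ[ℝ] ℝ := LinearMap.trace ℝ J ∘ₗ LinearMap.mul ℝ J

/-- For the derivation `D = [L(x), L(y)]` one has `L(Dz) = [D, L(z)]`, and a commutator has trace
zero. -/
lemma traceMul_mul_mul (x y z : J) :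
    traceMul (x * (y * z)) = traceMul (y * (x * z)) := by
  rw [← sub_eq_zero, ← map_sub]
  set X := LinearMap.mul ℝ J x
  set Y := LinearMap.mul ℝ J y
  set Z := LinearMap.mul ℝ J z
  have h : LinearMap.mul ℝ J (x * (y * z) - y * (x * z)) =
      (X * (Y * Z) - Y * (X * Z)) - (Z * (X * Y) - Z * (Y * X)) := by
    ext w
    exact (commutator_derivation x y z w).symm
  change LinearMap.trace ℝ J (LinearMap.mul ℝ J (x * (y * z) - y * (x * z))) = 0
  rw [h]
  simp only [map_sub]
  rw [← mul_assoc X Y Z, ← mul_assoc Y X Z, LinearMap.trace_mul_comm ℝ (X * Y),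
    LinearMap.trace_mul_comm ℝ (Y * X), sub_self]

variable [FiniteDimensional ℝ J]

/-- The Peirce space `J(c, 1)` of a primitive idempotent is one-dimensional. -/
lemma IsPrimitive.exists_eq_smul {c : J} (hc : IsPrimitive ⊤ c) {x : J} (hx : c * x = x) :
    ∃ a : ℝ, x = a • c := by
  obtain ⟨r, p, ξ, hp, hres, hxp⟩ := exists_jordanFrame x
  by_cases hξ : ∀ i, ξ i = 0
  · exact ⟨0, by simp [hxp, hξ]⟩
  obtain ⟨i, hi⟩ := not_forall.1 hξ
  have hcc := hc.2.1.2
  have hf : (1 - c) * (1 - c) = 1 - c :=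
    sub_mul_sub_idempotent hcc (mul_one 1) (one_mul c)
  -- Expanding `x²` gives a sum of nonnegative terms, so any spectral idempotent with nonzero
  -- coefficient is orthogonal to `1 - c`. It then lies below `c` and equals `c` by primitivity.
  have h0 : inner ℝ (x * x) (1 - c) = 0 := by
    rw [inner_mul_assoc, mul_sub, mul_one, mul_comm x c, hx, sub_self, inner_zero_right]
  have hnn : ∀ j, 0 ≤ inner ℝ (p j) (1 - c) := fun j => inner_idempotent_nonneg (hres.idem j) hf
  rw [hxp, hres.sum_smul_mul_sum_smul, sum_inner] at h0
  simp only [real_inner_smul_left] at h0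
  rw [Finset.sum_eq_zero_iff_of_nonneg fun j _ => mul_nonneg (mul_self_nonneg _) (hnn j)] at h0
  have h1 := (mul_eq_zero.1 (h0 i (Finset.mem_univ i))).resolve_left (mul_self_ne_zero.2 hi)
  have h2 := mul_eq_zero_of_inner_eq_zero (hres.idem i) hf h1
  have hcp : c * p i = p i := by
    rw [mul_sub, mul_one, sub_eq_zero, mul_comm] at h2
    exact h2.symm
  have hpc : p i = c := by
    by_contra hne
    refine hc.2.2 ⟨p i, Submodule.mem_top, c - p i, Submodule.mem_top, (hp.1 i).2.1,
      ⟨sub_ne_zero.2 (Ne.symm hne), sub_mul_sub_idempotent (hres.idem i) hcc hcp⟩,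
      add_sub_cancel _ _⟩
  refine ⟨ξ i, ?_⟩
  rw [← hx, mul_comm, ← hpc]
  conv_lhs => rw [hxp]
  rw [hres.sum_smul_mul]

/-- By the Peirce polynomial, `P(c)` takes values in `J(c, 1)`, which is a line. -/
lemma IsPrimitive.exists_quadRep_eq_smul {c : J} (hc : IsPrimitive ⊤ c) (d : J) :
    ∃ a : ℝ, quadRep c d = a • c := by
  refine hc.exists_eq_smul ?_
  have h := mul_mul_mul_idempotent hc.2.1.2 d
  rw [quadRep_apply, hc.2.1.2, mul_sub, mul_smul_comm, h]
  module

lemma continuous_quadL : Continuous (quadL : J → J →L[ℝ] J) := by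
  have h : Continuous fun x : J => mulL J (x * x) := (mulL J).continuous.comp continuous_sq
  unfold quadL
  fun_prop

lemma squares_subset_closure_cone : squares J ⊆ closure (cone J) := by
  rintro _ ⟨v, rfl⟩
  obtain ⟨r, c, ξ, -, hres, rfl⟩ := exists_jordanFrame v
  have hlim : Filter.Tendsto (fun t : ℝ => ∑ i, (ξ i * ξ i + t) • c i)
      (nhdsWithin 0 (Set.Ioi 0)) (nhds (∑ i, (ξ i * ξ i) • c i)) := by
    have hc : Continuous fun t : ℝ => ∑ i, (ξ i * ξ i + t) • c i := by fun_prop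
    have := hc.tendsto 0
    simp only [add_zero] at this
    exact this.mono_left nhdsWithin_le_nhds
  change (∑ i, ξ i • c i) * (∑ i, ξ i • c i) ∈ _
  rw [hres.sum_smul_mul_sum_smul]
  refine mem_closure_of_tendsto hlim ?_
  filter_upwards [self_mem_nhdsWithin] with t ht
  have ht : 0 < t := ht
  exact hres.sum_smul_mem_cone fun i => add_pos_of_nonneg_of_pos (mul_self_nonneg _) ht

/-- The fundamental formula for squares. -/
lemma quadL_quadRep_of_mem_squares {x : J} (hx : x ∈ squares J) (y : J) :
    quadL (quadRep x y) = quadL x * quadL y * quadL x := by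
  have hcont := continuous_quadL (J := J)
  have hclosed : IsClosed {x : J | quadL (quadL x y) = quadL x * quadL y * quadL x} :=
    isClosed_eq (hcont.comp (hcont.clm_apply continuous_const)) (by fun_prop)
  exact closure_minimal (fun z hz => quadL_quadRep hz y) hclosed (squares_subset_closure_cone hx)

/-- An associative functional takes the same value at non-orthogonal primitive idempotents. -/
lemma IsPrimitive.apply_eq_of_inner_ne_zero {φ : J →ₗ[ℝ] ℝ}
    (hφ : ∀ x y z, φ (x * (y * z)) = φ (y * (x * z))) {c d : J} (hc : IsPrimitive ⊤ c)
    (hd : IsPrimitive ⊤ d) (hcd : inner ℝ c d ≠ 0) : φ c = φ d := by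
  obtain ⟨a, ha⟩ := hc.exists_quadRep_eq_smul d
  obtain ⟨b, hb⟩ := hd.exists_quadRep_eq_smul c
  have hcc := hc.2.1.2
  have hdd := hd.2.1.2
  have hquad : ∀ u v : J, u * u = u → φ (quadRep u v) = φ (u * v) := by
    intro u v hu
    have h1 : φ (u * (u * v)) = φ (u * v) := by
      rw [mul_comm u v, hφ, hu, mul_comm]
    rw [quadRep_apply, hu, map_sub, map_smul, h1, smul_eq_mul]
    ring
  have h1 : φ (c * d) = a * φ c := by rw [← hquad c d hcc, ha, map_smul, smul_eq_mul]
  have h2 : φ (c * d) = b * φ d := by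
    rw [mul_comm, ← hquad d c hdd, hb, map_smul, smul_eq_mul]
  have hself : quadRep c c = c := by
    rw [quadRep_apply, hcc, hcc]; module
  have ha0 : a ≠ 0 := by
    rintro rfl
    have h3 := inner_quadRep c d c
    rw [ha, hself, zero_smul, inner_zero_left, real_inner_comm] at h3
    exact hcd h3.symm
  -- With `P(c)d = ac` and `P(d)c = bd`, evaluating `P(P(c)d) = P(c)P(d)P(c)` at `c` gives `a² =
  -- ba`. Then `aφ(c) = φ(cd) = bφ(d)` concludes, as `a ≠ 0`.
  have h4 := DFunLike.congr_fun (quadL_quadRep_of_mem_squares ⟨c, hcc⟩ d) c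
  have h5 : quadRep (a • c) c = (a * a) • c := by
    rw [quadRep_apply]
    simp only [smul_mul_assoc, mul_smul_comm, hcc]
    module
  simp only [mul_apply_eq_comp, quadL_apply] at h4
  rw [ha, h5, hself, hb, map_smul, ha, smul_smul] at h4
  have h6 : a = b := by
    have := smul_left_injective ℝ hc.2.1.1 h4
    exact mul_right_cancel₀ ha0 this
  rw [h1, ← h6] at h2
  exact mul_left_cancel₀ ha0 h2

/-- In a simple algebra, an associative functional is constant on primitive idempotents. -/
lemma IsPrimitive.apply_eq [IsSimpleRing J] {φ : J →ₗ[ℝ] ℝ}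
    (hφ : ∀ x y z, φ (x * (y * z)) = φ (y * (x * z))) {c d : J} (hc : IsPrimitive ⊤ c)
    (hd : IsPrimitive ⊤ d) : φ c = φ d := by
  by_contra hne
  -- Primitive idempotents with different values of `φ` are orthogonal, so the two classes span
  -- complementary subspaces annihilating each other. `A` is then a nonzero ideal, and simplicity
  -- leaves no room for `d`.
  set A : Submodule ℝ J := Submodule.span ℝ {p | IsPrimitive ⊤ p ∧ φ p = φ c} with hA
  set B : Submodule ℝ J := Submodule.span ℝ {p | IsPrimitive ⊤ p ∧ φ p ≠ φ c} with hB
  have hAB : ∀ u ∈ A, ∀ v ∈ B, u * v = 0 := by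
    intro u hu v hv
    induction hu, hv using Submodule.span_induction₂ with
    | mem_mem p q hp hq =>
      refine mul_eq_zero_of_inner_eq_zero hp.1.2.1.2 hq.1.2.1.2 ?_
      by_contra h
      exact hq.2 ((hp.1.apply_eq_of_inner_ne_zero hφ hq.1 h).symm.trans hp.2)
    | zero_left => exact zero_mul _
    | zero_right => exact mul_zero _
    | add_left _ _ _ _ _ _ h1 h2 => rw [add_mul, h1, h2, add_zero]
    | add_right _ _ _ _ _ _ h1 h2 => rw [mul_add, h1, h2, add_zero]
    | smul_left _ _ _ _ _ h => rw [smul_mul_assoc, h, smul_zero]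
    | smul_right _ _ _ _ _ h => rw [mul_smul_comm, h, smul_zero]
  have hinner : ∀ u ∈ A, ∀ v ∈ B, inner ℝ u v = 0 := by
    intro u hu v hv
    rw [← one_mul u, inner_mul_assoc, hAB u hu v hv, inner_zero_right]
  have hsup : ∀ x : J, ∃ u ∈ A, ∃ v ∈ B, u + v = x := by
    intro x
    rw [← Submodule.mem_sup]
    obtain ⟨r, p, ξ, hp, -, rfl⟩ := exists_jordanFrame x
    refine Submodule.sum_mem _ fun i _ => Submodule.smul_mem _ _ ?_
    by_cases h : φ (p i) = φ c
    · exact Submodule.mem_sup_left (Submodule.subset_span ⟨hp.1 i, h⟩)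
    · exact Submodule.mem_sup_right (Submodule.subset_span ⟨hp.1 i, h⟩)
  have hAA : ∀ u ∈ A, ∀ v ∈ A, u * v ∈ A := by
    intro u hu v hv
    obtain ⟨a, ha, b, hb, hab⟩ := hsup (u * v)
    -- The `B`-component of `uv` is orthogonal to itself, because `v` annihilates `B`.
    have h0 : inner ℝ (a + b) b = (0 : ℝ) := by
      rw [hab, inner_mul_assoc, hAB v hv b hb, inner_zero_right]
    rw [inner_add_left, hinner a ha b hb, zero_add, inner_self_eq_zero] at h0
    rw [← hab, h0, add_zero]
    exact ha
  have hmul : ∀ u ∈ A, ∀ x : J, u * x ∈ A := by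
    intro u hu x
    obtain ⟨a, ha, b, hb, rfl⟩ := hsup x
    rw [mul_add, hAB u hu b hb, add_zero]
    exact hAA u hu a ha
  let I : TwoSidedIdeal J := TwoSidedIdeal.mk' A A.zero_mem A.add_mem A.neg_mem
    (fun {x y} hy => mul_comm y x ▸ hmul y hy x) (fun {x y} hx => hmul x hx y)
  have hI : ∀ x, x ∈ I ↔ x ∈ A := fun x => TwoSidedIdeal.mem_mk' _ _ _ _ _ _ x
  have hcI : c ∈ I := (hI c).2 (Submodule.subset_span ⟨hc, rfl⟩)
  rcases eq_bot_or_eq_top I with h | h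
  · rw [h, TwoSidedIdeal.mem_bot] at hcI
    exact hc.2.1.1 hcI
  · have h1 : (1 : J) ∈ A := (hI 1).1 (h ▸ trivial)
    refine hd.2.1.1 ?_
    rw [← one_mul d]
    exact hAB 1 h1 d (Submodule.subset_span ⟨hd, fun e => hne e.symm⟩)

variable (J) in
lemma exists_isPrimitive [IsSimpleRing J] : ∃ c : J, IsPrimitive ⊤ c := by
  obtain ⟨r, c, ξ, hc, hres, -⟩ := exists_jordanFrame (1 : J)
  rcases r with - | r
  · exact absurd (hres.sum_eq_one.symm.trans (by simp)) (one_ne_zero (α := J))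
  · exact ⟨c 0, hc.1 0⟩

lemma apply_eq_mul_tr [IsSimpleRing J] {φ : J →ₗ[ℝ] ℝ}
    (hφ : ∀ x y z, φ (x * (y * z)) = φ (y * (x * z))) {c : J} (hc : IsPrimitive ⊤ c) (x : J) :
    φ x = φ c * tr ⊤ x := by
  obtain ⟨r, p, ξ, hp, hx, hs⟩ := eigenvalues_spec x
  rw [tr, hs]
  conv_lhs => rw [hx]
  rw [map_sum, Finset.sum_map_val, Finset.mul_sum]
  refine Finset.sum_congr rfl fun i _ => ?_
  rw [map_smul, smul_eq_mul, (hp.1 i).apply_eq hφ hc, mul_comm]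

/-- The trace is proportional to `⟨1, ·⟩`, and symmetry of `P(b)` with `b² = y` gives `⟨1, P(b)x⟩ =
⟨y, x⟩ = ⟨1, xy⟩`. -/
lemma tr_star [IsSimpleRing J] (x : J) {y : J} (hy : y ∈ cone J) :
    tr ⊤ (star y x) = tr ⊤ (x * y) := by
  obtain ⟨c, hc⟩ := exists_isPrimitive J
  let φ : J →ₗ[ℝ] ℝ := innerₗ J 1
  have hφ : ∀ x y z, φ (x * (y * z)) = φ (y * (x * z)) := by
    intro x y z
    simp only [φ, innerₗ_apply_apply]
    simp only [← inner_mul_assoc, one_mul]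
    rw [mul_comm x y]
  have hφc : φ c ≠ 0 := by
    simp only [φ, innerₗ_apply_apply]
    rw [← hc.2.1.2, real_inner_comm, inner_sq_one]
    exact pow_ne_zero 2 (norm_ne_zero_iff.2 hc.2.1.1)
  refine mul_left_cancel₀ hφc ?_
  rw [← apply_eq_mul_tr hφ hc, ← apply_eq_mul_tr hφ hc]
  simp only [φ, innerₗ_apply_apply]
  rw [star, ← inner_quadRep, quadRep_one_right, (sqrt_spec hy).2, ← inner_mul_comm, mul_one,
    real_inner_comm]

/-! ### Determinants -/

lemma det_trace_of_basis {ι V : Type*} [Fintype ι] [AddCommGroup V] [Module ℝ V]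
    (b : Module.Basis ι ℝ V) {f : V →ₗ[ℝ] V} {μ : ι → ℝ} (h : ∀ i, f (b i) = μ i • b i) :
    LinearMap.det f = ∏ i, μ i ∧ LinearMap.trace ℝ V f = ∑ i, μ i := by
  classical
  have hm : LinearMap.toMatrix b b f = Matrix.diagonal μ := by
    ext i j
    rw [LinearMap.toMatrix_apply, h, map_smul, Finsupp.smul_apply, b.repr_self,
      Finsupp.single_apply, Matrix.diagonal_apply]
    by_cases hij : i = j
    · simp [hij]
    · simp [hij, Ne.symm hij]
  rw [← LinearMap.det_toMatrix b, LinearMap.trace_eq_matrix_trace ℝ b, hm, Matrix.det_diagonal,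
    Matrix.trace_diagonal]
  exact ⟨rfl, rfl⟩

lemma det_exp_mulL (z : J) :
    LinearMap.det ((NormedSpace.exp (mulL J z) : J →L[ℝ] J) : J →ₗ[ℝ] J) = Real.exp (traceMul z) := by
  have hsym : (mulL J z : J →ₗ[ℝ] J).IsSymmetric := fun u v => inner_mul_comm z u v
  set b := hsym.eigenvectorBasis rfl
  set e := hsym.eigenvalues rfl
  have hb : ∀ i, mulL J z (b i) = e i • b i := fun i => hsym.apply_eigenvectorBasis rfl i
  have h1 := (det_trace_of_basis b.toBasis (f := LinearMap.mul ℝ J z) (μ := e) fun i => by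
    rw [b.coe_toBasis]; exact hb i).2
  rw [(det_trace_of_basis b.toBasis (μ := fun i => Real.exp (e i)) fun i => by
    rw [b.coe_toBasis]; exact exp_apply_of_eigenvector (hb i)).1, ← Real.exp_sum]
  exact congrArg Real.exp h1.symm

lemma det_pos {x : J} (hx : x ∈ cone J) : 0 < det ⊤ x := by
  obtain ⟨r, c, ξ, hc, hxc, hs⟩ := eigenvalues_spec x
  rw [det, hs, Finset.prod_map_val]
  exact Finset.prod_pos fun i _ => hc.isResolution.pos_of_sum_smul_mem_cone (hxc ▸ hx)
    (hc.1 i).2.1.1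

/-- Here `P(x) = exp (2L(log x))`, and `Tr L` takes the same value on every idempotent of a frame.
-/
lemma det_quadL [IsSimpleRing J] {x : J} (hx : x ∈ cone J) {c : J} (hc : IsPrimitive ⊤ c) :
    LinearMap.det (quadL x : J →ₗ[ℝ] J) =
      Real.exp (2 * traceMul c * Real.log (det ⊤ x)) := by
  obtain ⟨r, p, ξ, hp, hxp, hs⟩ := eigenvalues_spec x
  have hres := hp.isResolution
  have hξ : ∀ i, 0 < ξ i := fun i =>
    hres.pos_of_sum_smul_mem_cone (hxp ▸ hx) (hp.1 i).2.1.1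
  rw [det, hs, Finset.prod_map_val, Real.log_prod fun i _ => (hξ i).ne']
  conv_lhs => rw [hxp, ← hres.exp_mulL_log hξ, quadL_exp_one, det_exp_mulL]
  rw [map_smul, map_sum, smul_eq_mul, mul_assoc, Finset.mul_sum _ _ (traceMul c)]
  refine congrArg (fun t => Real.exp (2 * t)) (Finset.sum_congr rfl fun i _ => ?_)
  rw [map_smul, smul_eq_mul, (hp.1 i).apply_eq traceMul_mul_mul hc, mul_comm]

/-- Otherwise `Tr L`, a multiple of `tr`, would vanish at `1`, where it equals `dim J`. -/
lemma traceMul_ne_zero [IsSimpleRing J] {c : J} (hc : IsPrimitive ⊤ c) : traceMul c ≠ 0 := by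
  intro h0
  have h1 := apply_eq_mul_tr traceMul_mul_mul hc (1 : J)
  have h2 : traceMul (1 : J) = Module.finrank ℝ J := by
    have : LinearMap.mul ℝ J 1 = 1 := by ext; simp
    change LinearMap.trace ℝ J (LinearMap.mul ℝ J 1) = _
    rw [this, LinearMap.trace_one]
  have : Nontrivial J := ⟨c, 0, hc.2.1.1⟩
  have h3 : (0 : ℝ) < Module.finrank ℝ J := Nat.cast_pos.2 Module.finrank_pos
  rw [h0, h2] at h1
  linarith

/-- Take operator determinants in `P(x ⋆ y) = P(a)P(y)P(a)` with `a² = x`. The common exponent in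
`det_quadL` is nonzero, so it cancels. -/
lemma det_star [IsSimpleRing J] {x y : J} (hx : x ∈ cone J) (hy : y ∈ cone J) :
    det ⊤ (star x y) = det ⊤ x * det ⊤ y := by
  obtain ⟨c, hc⟩ := exists_isPrimitive J
  obtain ⟨ha, hax⟩ := sqrt_spec hx
  have h : LinearMap.det (quadL (star x y) : J →ₗ[ℝ] J) =
      LinearMap.det (quadL x : J →ₗ[ℝ] J) * LinearMap.det (quadL y : J →ₗ[ℝ] J) := by
    conv_rhs => rw [← hax]
    rw [star, quadL_quadRep ha, quadL_mul_self ha]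
    have hm : ∀ A B : J →L[ℝ] J, LinearMap.det ((A * B : J →L[ℝ] J) : J →ₗ[ℝ] J) =
        LinearMap.det (A : J →ₗ[ℝ] J) * LinearMap.det (B : J →ₗ[ℝ] J) := fun A B =>
      LinearMap.det_comp _ _
    simp only [hm]
    ring
  rw [det_quadL (star_mem_cone hx hy) hc, det_quadL hx hc, det_quadL hy hc, ← Real.exp_add,
    ← mul_add] at h
  have h1 := mul_left_cancel₀ (mul_ne_zero two_ne_zero (traceMul_ne_zero hc))
    (Real.exp_injective h)
  rw [← Real.log_mul (det_pos hx).ne' (det_pos hy).ne'] at h1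
  exact Real.log_injOn_pos (det_pos (star_mem_cone hx hy)) (mul_pos (det_pos hx) (det_pos hy)) h1

end Trace

end EuclideanJordanAlgebra

universe u v

open EuclideanJordanAlgebra in
theorem mainTheorem9 {J : Type u} [EuclideanJordanAlgebra J] [FiniteDimensional ℝ J]
    [IsSimpleRing J] (x y : J) (hx : x ∈ cone J) (hy : y ∈ cone J) :
    -- (a)
    (star x 1 = x ∧ star 1 x = x) ∧
    (star x (inv x) = 1 ∧ star (inv x) x = 1) ∧
    inv (star x y) = star (inv x) (inv y) ∧
    -- (b)
    eigenvalues ⊤ (star x y) = eigenvalues ⊤ (star y x) ∧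
    (∃ (hxy : star x y ∈ cone J) (hyx : star y x ∈ cone J),
      ∀ (α : Type v) (f : cone J → α), IsKInvariant f →
        f ⟨star x y, hxy⟩ = f ⟨star y x, hyx⟩) ∧
    (det ⊤ (star x y) = det ⊤ (star y x) ∧ det ⊤ (star y x) = det ⊤ x * det ⊤ y) ∧
    (tr ⊤ (star x y) = tr ⊤ (star y x) ∧ tr ⊤ (star y x) = tr ⊤ (x * y)) ∧
    (∀ (r : ℕ) (c : Fin r → J) (l : Fin r → ℕ), IsJordanFrame ⊤ c → Antitone l →
      zonal c l (star x y) = zonal c l (star y x)) := by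
  obtain ⟨k, hk, hkxy, hmul⟩ := exists_groupK_smul_star hx hy
  have hxy := star_mem_cone hx hy
  have hyx := star_mem_cone hy hx
  have heig : eigenvalues ⊤ (star x y) = eigenvalues ⊤ (star y x) := by
    rw [← hkxy, eigenvalues_smul hmul]
  have hinv := star_inv_self (inv_mem_cone hx)
  rw [inv_inv_of_mem_cone hx] at hinv
  refine ⟨⟨star_one_right hx, star_one_left x⟩, ⟨star_inv_self hx, hinv⟩, inv_star hx hy, heig,
    ⟨hxy, hyx, fun α f hf => hf k hk ⟨_, hyx⟩ ⟨_, hxy⟩ hkxy⟩, ⟨by rw [det, heig, det], ?_⟩,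
    ⟨by rw [tr, heig, tr], tr_star x hy⟩, fun r c l _ _ => ?_⟩
  · rw [det_star hy hx, mul_comm]
  · rw [← hkxy, zonal_smul c l hk]
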